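/- **Setting.** Let $K$ be a finite simplicial complex with face relation $\le$, and let $H_*$ denote simplicial homology with coefficients in a fixed field $F$. For $A\subseteq K$ let $\operatorname{cl}(A)$ be the set of all faces of simplices of $A$ and $\operatorname{mo}(A)=\operatorname{cl}(A)\setminus A$; $A$ is closed if $A=\operatorname{cl}(A)$. A *multivector field* $\mathcal V$ is a partition of $K$ into sets that are convex for $\le$; $[\sigma]_{\mathcal V}$ is the class of $\sigma$, and $F_{\mathcal V}(\sigma)=\operatorname{cl}(\sigma)\cup[\sigma]_{\mathcal V}$, $F_{\mathcal V}(A)=\bigcup_{\sigma\in A}F_{\mathcal V}(\sigma)$. A class $W$ is *critical* if $H_*(\operatorname{cl}W,\operatorname{mo}W)\ne 0$. A *path* in $N\subseteq K$ is a map $\rho:\{0,\dots,\ell\}\to N$ with $\rho(i+1)\in F_{\mathcal V}(\rho(i))$; a *solution* is a map $\rho:\mathbb Z\to K$ with the same property. A solution is *essential* if for each $i$ with $[\rho(i)]_{\mathcal V}$ not critical there are $i^-<i<i^+$ with $[\rho(i^-)]_{\mathcal V}\neq[\rho(i)]_{\mathcal V}\neq[\rho(i^+)]_{\mathcal V}$.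 The invariant part $\operatorname{inv}_{\mathcal V}(A)$ is the set of simplices lying on an essential solution contained in $A$. A set $S=\operatorname{inv}_{\mathcal V}(S)$ is an *isolated invariant set* if there is a closed $N\supseteq F_{\mathcal V}(S)$ such that every path in $N$ with both endpoints in $S$ lies in $S$. An *index pair* for such an $S$ under $\mathcal V$ is a pair of closed sets $E\subseteq P$ with $F_{\mathcal V}(P\setminus E)\subseteq P$, $F_{\mathcal V}(E)\cap P\subseteq E$ and $S=\operatorname{inv}_{\mathcal V}(P\setminus E)$. The *push forward* $\operatorname{pf}_{\mathcal V}(A,N)$ is the set of endpoints of paths in $N$ that start in $A$. **Theorem.** Let $n\ge 1$, let $\mathcal V_1,\dots,\mathcal V_{n+1}$ be multivector fields on $K$, let $S_i$ be an isolated invariant set under $\mathcal V_i$ for $1\le i\le n+1$, and let $(P_1,E_1),\dots,(P_n,E_n)$ be a sequence of connecting index pairs, that is, for $1\le i\le n$ the pair $(P_i,E_i)$ is an index pair both for $S_i$ under $\mathcal V_i$ and for $S_{i+1}$ under $\mathcal V_{i+1}$. For $1\le i<n$ and $j\in\{i,i+1\}$ put $$(A_{i,j},B_{i,j})=\big(\operatorname{pf}_{\mathcal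 V_{i+1}}(\operatorname{cl}(S_{i+1}),P_j),\ \operatorname{pf}_{\mathcal V_{i+1}}(\operatorname{mo}(S_{i+1}),P_j)\big).$$ Join $(P_i,E_i)$ to $(P_{i+1},E_{i+1})$ by $$(P_i,E_i)\supseteq(P_i\cap A_{i,i},E_i\cap B_{i,i})\subseteq(A_{i,i},B_{i,i})\supseteq(\operatorname{cl}(S_{i+1}),\operatorname{mo}(S_{i+1}))\subseteq(A_{i,i+1},B_{i,i+1})\supseteq(P_{i+1}\cap A_{i,i+1},E_{i+1}\cap B_{i,i+1})\subseteq(P_{i+1},E_{i+1}),$$ and concatenate these for $i=1,\dots,n-1$ to a zigzag filtration of pairs of closed sets from $(P_1,E_1)$ to $(P_n,E_n)$. Then for every $k\ge 0$ the barcode of this zigzag filtration in dimension $k$ (the multiset of intervals in a decomposition of the zigzag module of the groups $H_k$, with the maps induced by the inclusions, into interval modules) consists of exactly $m=\dim_F H_k(P_1,E_1)$ bars, each of which is the full bar that lives from $(P_1,E_1)$ to $(P_n,E_n)$ (written $[1,n]$). Here the barcode exists and is unique. -/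

import Mathlib

set_option linter.unusedSectionVars false

namespace CombDyn

/-! ### Quotients of one subspace by another -/

section Subquotient

variable {R M : Type*} [Ring R] [AddCommGroup M] [Module R M]

/-- The quotient `Z / B` of two submodules `B ≤ Z` of `M`. -/
def Subquotient (Z B : Submodule R M) := Z ⧸ B.submoduleOf Z

noncomputable instance (Z B : Submodule R M) : AddCommGroup (Subquotient Z B) :=
  inferInstanceAs (AddCommGroup (Z ⧸ B.submoduleOf Z))

noncomputable instance (Z B : Submodule R M) : Module R (Subquotient Z B) :=
  inferInstanceAs (Module R (Z ⧸ B.submoduleOf Z))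

/-- The map `Z / B → Z' / B'`, `[z] ↦ [z]`, for `Z ≤ Z'` and `B ≤ B'`. -/
noncomputable def Subquotient.map {Z B Z' B' : Submodule R M} (hZ : Z ≤ Z') (hB : B ≤ B') :
    Subquotient Z B →ₗ[R] Subquotient Z' B' :=
  Submodule.mapQ (B.submoduleOf Z) (B'.submoduleOf Z') (Submodule.inclusion hZ) fun _ hx => hB hx

end Subquotient

/-! ### Relative simplicial homology

`K` is an abstract simplicial complex on a linearly ordered vertex set; its simplices are the
elements of `K.faces` (nonempty finite vertex sets), and `σ ≤ τ` means that `σ` is a face of `τ`. -/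

section Homology

variable {V : Type*} [LinearOrder V] {K : PreAbstractSimplicialComplex V}

/-- The simplicial boundary operator on the direct sum of all chain groups of `K`:
`∂[v₀ < ⋯ < vₖ] = ∑ᵢ (-1)ⁱ [v₀, …, v̂ᵢ, …, vₖ]`, and `∂[v₀] = 0`. The number of vertices of `σ`
below `v` is the position of `v` in `σ`. -/
noncomputable def boundary (F : Type*) [Field F] (K : PreAbstractSimplicialComplex V) :
    (K.faces →₀ F) →ₗ[F] (K.faces →₀ F) :=
  open Classical in
  Finsupp.linearCombination F fun σ : K.faces =>
    ∑ v ∈ σ.1, if h : σ.1.erase v ∈ K.faces then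
      Finsupp.single (⟨σ.1.erase v, h⟩ : K.faces) ((-1 : F) ^ (σ.1.filter (· < v)).card) else 0

/-- `C_k(A)`: the `k`-chains supported on the set of simplices `A`. -/
noncomputable def chains (F : Type*) [Field F] (k : ℕ) (A : Set K.faces) :
    Submodule F (K.faces →₀ F) :=
  Finsupp.supported F F {σ : K.faces | σ ∈ A ∧ σ.1.card = k + 1}

/-- Relative `k`-cycles of `(P, E)`: the chains in `C_k(P)` whose boundary lies in `E`. -/
noncomputable def relCycles (F : Type*) [Field F] (k : ℕ) (P E : Set K.faces) :
    Submodule F (K.faces →₀ F) :=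
  chains F k P ⊓ (Finsupp.supported F F E).comap (boundary F K)

/-- Relative `k`-boundaries of `(P, E)`: `∂ C_{k+1}(P) + C_k(E)`. -/
noncomputable def relBoundaries (F : Type*) [Field F] (k : ℕ) (P E : Set K.faces) :
    Submodule F (K.faces →₀ F) :=
  (chains F (k + 1) P).map (boundary F K) ⊔ chains F k E

/-- The relative simplicial homology `H_k(P, E; F)` (for closed sets `E ⊆ P`), as relative cycles
modulo relative boundaries. -/
abbrev RelHomology (F : Type*) [Field F] (k : ℕ) (P E : Set K.faces) :=
  Subquotient (relCycles F k P E) (relBoundaries F k P E)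

theorem chains_mono (F : Type*) [Field F] (k : ℕ) {A B : Set K.faces} (h : A ⊆ B) :
    chains F k A ≤ chains F k B :=
  Finsupp.supported_mono fun _ hσ => ⟨h hσ.1, hσ.2⟩

theorem relCycles_mono (F : Type*) [Field F] (k : ℕ) {p q : Set K.faces × Set K.faces}
    (h : p ≤ q) : relCycles F k p.1 p.2 ≤ relCycles F k q.1 q.2 :=
  inf_le_inf (chains_mono F k h.1) (Submodule.comap_mono (Finsupp.supported_mono h.2))

theorem relBoundaries_mono (F : Type*) [Field F] (k : ℕ) {p q : Set K.faces × Set K.faces}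
    (h : p ≤ q) : relBoundaries F k p.1 p.2 ≤ relBoundaries F k q.1 q.2 :=
  sup_le_sup (Submodule.map_mono (chains_mono F (k + 1) h.1)) (chains_mono F k h.2)

/-- The map in relative homology induced by an inclusion of pairs `p ⊆ q`
(componentwise inclusion). -/
noncomputable def relHomologyMap (F : Type*) [Field F] (k : ℕ) {p q : Set K.faces × Set K.faces}
    (h : p ≤ q) : RelHomology F k p.1 p.2 →ₗ[F] RelHomology F k q.1 q.2 :=
  Subquotient.map (relCycles_mono F k h) (relBoundaries_mono F k h)

end Homology

/-! ### Multivector fields and isolated invariant sets -/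

section Dynamics

variable {V : Type*} [LinearOrder V] {K : PreAbstractSimplicialComplex V}

/-- The closure of a set of simplices: all faces of its elements. -/
def cl (A : Set K.faces) : Set K.faces := {τ | ∃ σ ∈ A, τ ≤ σ}

/-- The mouth of a set of simplices. -/
def mo (A : Set K.faces) : Set K.faces := cl A \ A

/-- A multivector field: a partition of `K` (given by its equivalence relation) all of whose
classes are convex with respect to the face relation. -/
structure MultivectorField (K : PreAbstractSimplicialComplex V) where
  toSetoid : Setoid K.faces
  convex : ∀ W ∈ toSetoid.classes, W.OrdConnected

namespace MultivectorField

/-- The multivector `[σ]` containing `σ`. -/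
def mv (𝒱 : MultivectorField K) (σ : K.faces) : Set K.faces := {τ | 𝒱.toSetoid τ σ}

/-- The multivalued map `F_𝒱(σ) = cl(σ) ∪ [σ]`. -/
def map (𝒱 : MultivectorField K) (σ : K.faces) : Set K.faces := cl {σ} ∪ 𝒱.mv σ

/-- `F_𝒱(A)`, the union of the `F_𝒱(σ)` over `σ ∈ A`. -/
def mapSet (𝒱 : MultivectorField K) (A : Set K.faces) : Set K.faces := ⋃ σ ∈ A, 𝒱.map σ

/-- `ρ` (restricted to `{0, …, n}`) is a path of `𝒱` in `A`. -/
def IsPath (𝒱 : MultivectorField K) (A : Set K.faces) (n : ℕ) (ρ : ℕ → K.faces) : Prop :=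
  (∀ i ≤ n, ρ i ∈ A) ∧ ∀ i < n, ρ (i + 1) ∈ 𝒱.map (ρ i)

/-- `ρ : ℤ → K` is a solution of `𝒱`. -/
def IsSolution (𝒱 : MultivectorField K) (ρ : ℤ → K.faces) : Prop :=
  ∀ i, ρ (i + 1) ∈ 𝒱.map (ρ i)

/-- The push forward of `A` in `N`: the endpoints of the paths in `N` that start in `A`. -/
def pf (𝒱 : MultivectorField K) (A N : Set K.faces) : Set K.faces :=
  {σ | ∃ n ρ, 𝒱.IsPath N n ρ ∧ ρ 0 ∈ A ∧ ρ n = σ}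

end MultivectorField

/-- A set of simplices `W` is critical if `H(cl W, mo W) ≠ 0`. -/
def IsCritical (F : Type*) [Field F] (W : Set K.faces) : Prop :=
  ∃ k, Nontrivial (RelHomology F k (cl W) (mo W))

namespace MultivectorField

/-- Essential solutions: before and after each visit to a noncritical multivector, the solution
visits some other multivector. -/
def IsEssential (F : Type*) [Field F] (𝒱 : MultivectorField K) (ρ : ℤ → K.faces) : Prop :=
  𝒱.IsSolution ρ ∧ ∀ i, ¬ IsCritical F (𝒱.mv (ρ i)) →
    ∃ i₁ i₂, i₁ < i ∧ i < i₂ ∧ 𝒱.mv (ρ i₁) ≠ 𝒱.mv (ρ i) ∧ 𝒱.mv (ρ i) ≠ 𝒱.mv (ρ i₂)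

/-- The invariant part of `A`. -/
def inv (F : Type*) [Field F] (𝒱 : MultivectorField K) (A : Set K.faces) : Set K.faces :=
  {σ | ∃ ρ, 𝒱.IsEssential F ρ ∧ (∀ i, ρ i ∈ A) ∧ ∃ i, ρ i = σ}

/-- `N` is an isolating set for the invariant set `S`. -/
structure IsIsolating (F : Type*) [Field F] (𝒱 : MultivectorField K) (S N : Set K.faces) :
    Prop where
  invariant : S = 𝒱.inv F S
  closed : IsLowerSet N
  map_subset : 𝒱.mapSet S ⊆ N
  path_mem : ∀ n ρ, 𝒱.IsPath N n ρ → ρ 0 ∈ S → ρ n ∈ S → ∀ i ≤ n, ρ i ∈ S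

/-- `S` is an isolated invariant set of `𝒱`. -/
def IsIsolatedInvariant (F : Type*) [Field F] (𝒱 : MultivectorField K) (S : Set K.faces) : Prop :=
  ∃ N, 𝒱.IsIsolating F S N

/-- `(P, E)` is an index pair for the isolated invariant set `S` of `𝒱`. -/
structure IsIndexPair (F : Type*) [Field F] (𝒱 : MultivectorField K) (S P E : Set K.faces) :
    Prop where
  isolated : 𝒱.IsIsolatedInvariant F S
  closed_fst : IsLowerSet P
  closed_snd : IsLowerSet E
  subset : E ⊆ P
  map_diff : 𝒱.mapSet (P \ E) ⊆ P
  map_exit : 𝒱.mapSet E ∩ P ⊆ E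
  inv_eq : S = 𝒱.inv F (P \ E)

end MultivectorField

/-- `(P₁, E₁), …, (Pₙ, Eₙ)` is a sequence of connecting index pairs for the sets `S₁, …, Sₙ₊₁`
under the multivector fields `𝒱₁, …, 𝒱ₙ₊₁`: the pair `(Pᵢ, Eᵢ)` is an index pair for `Sᵢ` under
`𝒱ᵢ` and for `Sᵢ₊₁` under `𝒱ᵢ₊₁`. Only the entries with indices in these ranges matter. -/
def IsConnectingSequence (F : Type*) [Field F] (n : ℕ) (𝒱 : ℕ → MultivectorField K)
    (S P E : ℕ → Set K.faces) : Prop :=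
  ∀ i, 1 ≤ i → i ≤ n →
    (𝒱 i).IsIndexPair F (S i) (P i) (E i) ∧ (𝒱 (i + 1)).IsIndexPair F (S (i + 1)) (P i) (E i)

end Dynamics

/-! ### Zigzag filtrations, zigzag modules and barcodes

An orientation `o : Fin L → Bool` of the `L` steps between the positions `0, …, L` says for each
step whether it points forward (`i → i + 1`, value `true`) or backward (`i ← i + 1`). -/

section Zigzag

/-- The source of the `i`-th arrow. -/
def src {L : ℕ} (o : Fin L → Bool) (i : Fin L) : Fin (L + 1) :=
  if o i then i.castSucc else i.succ

/-- The target of the `i`-th arrow. -/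
def tgt {L : ℕ} (o : Fin L → Bool) (i : Fin L) : Fin (L + 1) :=
  if o i then i.succ else i.castSucc

/-- A zigzag module: vector spaces at the positions `0, …, L` and one linear map per arrow. -/
structure ZigzagModule (F : Type*) [Field F] {L : ℕ} (o : Fin L → Bool) where
  obj : Fin (L + 1) → Type*
  [addCommGroup : ∀ i, AddCommGroup (obj i)]
  [module : ∀ i, Module F (obj i)]
  map : ∀ i, obj (src o i) →ₗ[F] obj (tgt o i)

attribute [instance] ZigzagModule.addCommGroup ZigzagModule.module

/-- Isomorphisms of zigzag modules. -/
structure ZigzagModule.Iso {F : Type*} [Field F] {L : ℕ} {o : Fin L → Bool}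
    (M N : ZigzagModule F o) where
  equiv : ∀ i, M.obj i ≃ₗ[F] N.obj i
  comm : ∀ i x, equiv (tgt o i) (M.map i x) = N.map i (equiv (src o i) x)

/-- The interval module of `J`: it is `F` (functions on a one-point type) at the positions in `J`
and `0` (functions on an empty type) elsewhere, with identity maps between positions in `J`. -/
noncomputable def intervalModule (F : Type*) [Field F] {L : ℕ} (o : Fin L → Bool)
    (J : NonemptyInterval (Fin (L + 1))) : ZigzagModule F o where
  obj i := PLift (i ∈ J) → F
  map i :=
    open Classical in
    { toFun := fun x _ => if h : src o i ∈ J then x ⟨h⟩ else 0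
      map_add' := fun x y => by
        funext _
        by_cases h : src o i ∈ J <;> simp [h]
      map_smul' := fun c x => by
        funext _
        by_cases h : src o i ∈ J <;> simp [h] }

/-- The direct sum of finitely many zigzag modules. -/
noncomputable def ZigzagModule.directSum {F : Type*} [Field F] {L : ℕ} {o : Fin L → Bool}
    {ι : Type} [Fintype ι] (M : ι → ZigzagModule F o) : ZigzagModule F o where
  obj i := ∀ j, (M j).obj i
  map i := LinearMap.pi fun j => (M j).map i ∘ₗ LinearMap.proj j

/-- The multiset `B` of intervals is a barcode of `M`: `M` is isomorphic to the direct sum of the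
interval modules of the members of `B`, counted with multiplicity. -/
def ZigzagModule.IsBarcode {F : Type*} [Field F] {L : ℕ} {o : Fin L → Bool}
    (M : ZigzagModule F o) (B : Multiset (NonemptyInterval (Fin (L + 1)))) : Prop :=
  ∃ (ι : Type) (_ : Fintype ι) (J : ι → NonemptyInterval (Fin (L + 1))),
    B = Finset.univ.val.map J ∧
      Nonempty (M.Iso (ZigzagModule.directSum fun j => intervalModule F o (J j)))

/-- The bar that lives at all the positions `0, …, L`. -/
def fullBar (L : ℕ) : NonemptyInterval (Fin (L + 1)) := ⟨(0, Fin.last L), Fin.zero_le _⟩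

variable {V : Type*} [LinearOrder V] {K : PreAbstractSimplicialComplex V}

/-- A zigzag filtration: a sequence of pairs `B ⊆ A` of closed sets, in which consecutive pairs
are related by an inclusion of pairs in the prescribed direction. -/
structure ZigzagFiltration (K : PreAbstractSimplicialComplex V) {L : ℕ} (o : Fin L → Bool) where
  pair : Fin (L + 1) → Set K.faces × Set K.faces
  closed_fst : ∀ i, IsLowerSet (pair i).1
  closed_snd : ∀ i, IsLowerSet (pair i).2
  subset : ∀ i, (pair i).2 ⊆ (pair i).1
  step : ∀ i, pair (src o i) ≤ pair (tgt o i)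

/-- The `k`-dimensional zigzag persistence module of a zigzag filtration: its relative homology
groups `H_k` with the maps induced by the inclusions. -/
noncomputable def ZigzagFiltration.homology (F : Type*) [Field F] (k : ℕ) {L : ℕ}
    {o : Fin L → Bool} (A : ZigzagFiltration K o) : ZigzagModule F o where
  obj i := RelHomology F k (A.pair i).1 (A.pair i).2
  map i := relHomologyMap F k (A.step i)

end Zigzag

/-! ### The zigzag filtration of a sequence of connecting index pairs -/

section Continuation

variable {V : Type*} [LinearOrder V] {K : PreAbstractSimplicialComplex V}

/-- With `i⁺ = i + 1`, the six pairs, for `r = 0, …, 5`, that lead from `(Pᵢ, Eᵢ)` through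
`(cl Sᵢ⁺, mo Sᵢ⁺)` to the pair just before `(Pᵢ⁺, Eᵢ⁺)`. All push forwards are taken with respect
to the multivector field `𝒱ᵢ⁺`. -/
def linkPair (𝒱 : ℕ → MultivectorField K) (S P E : ℕ → Set K.faces) (i : ℕ) :
    ℕ → Set K.faces × Set K.faces
  | 0 => (P i, E i)
  | 1 => (P i ∩ (𝒱 (i + 1)).pf (cl (S (i + 1))) (P i),
      E i ∩ (𝒱 (i + 1)).pf (mo (S (i + 1))) (P i))
  | 2 => ((𝒱 (i + 1)).pf (cl (S (i + 1))) (P i), (𝒱 (i + 1)).pf (mo (S (i + 1))) (P i))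
  | 3 => (cl (S (i + 1)), mo (S (i + 1)))
  | 4 => ((𝒱 (i + 1)).pf (cl (S (i + 1))) (P (i + 1)), (𝒱 (i + 1)).pf (mo (S (i + 1))) (P (i + 1)))
  | _ => (P (i + 1) ∩ (𝒱 (i + 1)).pf (cl (S (i + 1))) (P (i + 1)),
      E (i + 1) ∩ (𝒱 (i + 1)).pf (mo (S (i + 1))) (P (i + 1)))

/-- The pair at position `j` of the concatenated zigzag filtration; the pair `(Pᵢ, Eᵢ)` stands at
position `6 (i - 1)`. -/
def contPair (𝒱 : ℕ → MultivectorField K) (S P E : ℕ → Set K.faces) (j : ℕ) :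
    Set K.faces × Set K.faces :=
  linkPair 𝒱 S P E (j / 6 + 1) (j % 6)

/-- The alternating orientation: the inclusions are `0 ⊇ 1 ⊆ 2 ⊇ 3 ⊆ ⋯`. -/
def altOrientation (L : ℕ) : Fin L → Bool := fun i => decide (i.1 % 2 = 1)

theorem isLowerSet_cl (A : Set K.faces) : IsLowerSet (cl A) :=
  fun _ _ hba ⟨σ, hσ, h⟩ => ⟨σ, hσ, hba.trans h⟩

theorem MultivectorField.isLowerSet_pf (𝒱 : MultivectorField K) (A : Set K.faces)
    {N : Set K.faces} (hN : IsLowerSet N) : IsLowerSet (𝒱.pf A N) := by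
  rintro a b hba ⟨n, ρ, ⟨hρ, hs⟩, h0, rfl⟩
  refine ⟨n + 1, fun i => if i ≤ n then ρ i else b, ⟨fun i _ => ?_, fun i hi => ?_⟩, ?_, ?_⟩
  · by_cases h : i ≤ n
    · simpa [h] using hρ i h
    · simpa [h] using hN hba (hρ n le_rfl)
  · rcases Nat.lt_succ_iff_lt_or_eq.1 hi with h | rfl
    · simpa [h.le, Nat.succ_le_of_lt h] using hs i h
    · simpa [MultivectorField.map] using Or.inl (b := b ∈ 𝒱.mv (ρ i)) ⟨ρ i, rfl, hba⟩
  · simpa using h0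
  · simp

theorem MultivectorField.pf_mono (𝒱 : MultivectorField K) {A B : Set K.faces} (h : A ⊆ B)
    (N : Set K.faces) : 𝒱.pf A N ⊆ 𝒱.pf B N :=
  fun _ ⟨n, ρ, hρ, h0, hn⟩ => ⟨n, ρ, hρ, h h0, hn⟩

theorem MultivectorField.subset_pf (𝒱 : MultivectorField K) {A N : Set K.faces} (h : A ⊆ N) :
    A ⊆ 𝒱.pf A N :=
  fun σ hσ => ⟨0, fun _ => σ, ⟨fun _ _ => h hσ, fun _ hi => absurd hi (Nat.not_lt_zero _)⟩, hσ, rfl⟩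

theorem mo_subset_cl (A : Set K.faces) : mo A ⊆ cl A := Set.sdiff_subset

theorem MultivectorField.IsIsolatedInvariant.isLowerSet_mo {F : Type*} [Field F]
    {𝒱 : MultivectorField K} {S : Set K.faces} (hS : 𝒱.IsIsolatedInvariant F S) :
    IsLowerSet (mo S) := by
  obtain ⟨N, hN⟩ := hS
  rintro a b hba ⟨⟨σ, hσ, haσ⟩, ha⟩
  refine ⟨⟨σ, hσ, hba.trans haσ⟩, fun hb => ha ?_⟩
  have hσN : σ ∈ N := hN.map_subset (Set.mem_biUnion hσ (Or.inl ⟨σ, rfl, le_rfl⟩))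
  have haN : a ∈ N := hN.closed haσ hσN
  have hbN : b ∈ N := hN.closed hba haN
  refine hN.path_mem 2 (fun i => if i = 0 then σ else if i = 1 then a else b)
    ⟨fun i _ => ?_, fun i hi => ?_⟩ (by simpa using hσ) (by simpa using hb) 1 (by norm_num)
  · dsimp only
    split_ifs <;> assumption
  · interval_cases i
    · exact Or.inl ⟨σ, rfl, haσ⟩
    · exact Or.inl ⟨a, rfl, hba⟩

theorem MultivectorField.IsIndexPair.cl_subset {F : Type*} [Field F] {𝒱 : MultivectorField K}
    {S P E : Set K.faces} (h : 𝒱.IsIndexPair F S P E) : cl S ⊆ P := by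
  rintro τ ⟨σ, hσ, hτ⟩
  rw [h.inv_eq] at hσ
  obtain ⟨ρ, _, hρ, i, rfl⟩ := hσ
  exact h.closed_fst hτ (hρ i).1

theorem contPair_closed {F : Type*} [Field F] {n : ℕ} {𝒱 : ℕ → MultivectorField K}
    {S P E : ℕ → Set K.faces} (hn : 1 ≤ n) (h : IsConnectingSequence F n 𝒱 S P E) {j : ℕ}
    (hj : j ≤ 6 * (n - 1)) :
    IsLowerSet (contPair 𝒱 S P E j).1 ∧ IsLowerSet (contPair 𝒱 S P E j).2 ∧
      (contPair 𝒱 S P E j).2 ⊆ (contPair 𝒱 S P E j).1 := by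
  obtain ⟨q, r, hr, rfl⟩ : ∃ q r, r < 6 ∧ j = 6 * q + r :=
    ⟨j / 6, j % 6, Nat.mod_lt _ (by norm_num), (Nat.div_add_mod j 6).symm⟩
  have e1 : (6 * q + r) / 6 = q := by omega
  have e2 : (6 * q + r) % 6 = r := by omega
  obtain ⟨h1, h2⟩ := h (q + 1) (by omega) (by omega)
  simp only [contPair, e1, e2]
  have hmo := h2.isolated.isLowerSet_mo
  have hpf := fun A => (𝒱 (q + 1 + 1)).isLowerSet_pf A h1.closed_fst
  have hsub := fun N => (𝒱 (q + 1 + 1)).pf_mono (mo_subset_cl (S (q + 1 + 1))) N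
  rcases Nat.eq_zero_or_pos r with rfl | hr0
  · exact ⟨h1.closed_fst, h1.closed_snd, h1.subset⟩
  obtain ⟨h3, _⟩ := h (q + 1 + 1) (by omega) (by omega)
  have hpf' := fun A => (𝒱 (q + 1 + 1)).isLowerSet_pf A h3.closed_fst
  interval_cases r
  · exact ⟨h1.closed_fst.inter (hpf _), h1.closed_snd.inter (hpf _),
      Set.inter_subset_inter h1.subset (hsub _)⟩
  · exact ⟨hpf _, hpf _, hsub _⟩
  · exact ⟨isLowerSet_cl _, hmo, mo_subset_cl _⟩
  · exact ⟨hpf' _, hpf' _, hsub _⟩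
  · exact ⟨h3.closed_fst.inter (hpf' _), h3.closed_snd.inter (hpf' _),
      Set.inter_subset_inter h3.subset (hsub _)⟩

theorem contPair_step {F : Type*} [Field F] {n : ℕ} {𝒱 : ℕ → MultivectorField K}
    {S P E : ℕ → Set K.faces} (h : IsConnectingSequence F n 𝒱 S P E) {j : ℕ}
    (hj : j < 6 * (n - 1)) :
    (j % 2 = 1 → contPair 𝒱 S P E j ≤ contPair 𝒱 S P E (j + 1)) ∧
      (¬ j % 2 = 1 → contPair 𝒱 S P E (j + 1) ≤ contPair 𝒱 S P E j) := by
  obtain ⟨q, r, hr, rfl⟩ : ∃ q r, r < 6 ∧ j = 6 * q + r :=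
    ⟨j / 6, j % 6, Nat.mod_lt _ (by norm_num), (Nat.div_add_mod j 6).symm⟩
  have e1 : (6 * q + r) / 6 = q := by omega
  have e2 : (6 * q + r) % 6 = r := by omega
  obtain ⟨_, h2⟩ := h (q + 1) (by omega) (by omega)
  obtain ⟨h3, _⟩ := h (q + 1 + 1) (by omega) (by omega)
  have hsub := (𝒱 (q + 1 + 1)).subset_pf h2.cl_subset
  have hsub' := (𝒱 (q + 1 + 1)).subset_pf h3.cl_subset
  have msub := (𝒱 (q + 1 + 1)).subset_pf ((mo_subset_cl _).trans h2.cl_subset)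
  have msub' := (𝒱 (q + 1 + 1)).subset_pf ((mo_subset_cl _).trans h3.cl_subset)
  simp only [contPair, e1, e2]
  rcases Nat.lt_or_ge r 5 with hr5 | hr5
  · have e3 : (6 * q + r + 1) / 6 = q := by omega
    have e4 : (6 * q + r + 1) % 6 = r + 1 := by omega
    rw [e3, e4]
    interval_cases r
    · exact ⟨by omega, fun _ => ⟨Set.inter_subset_left, Set.inter_subset_left⟩⟩
    · exact ⟨fun _ => ⟨Set.inter_subset_right, Set.inter_subset_right⟩, by omega⟩
    · exact ⟨by omega, fun _ => ⟨hsub, msub⟩⟩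
    · exact ⟨fun _ => ⟨hsub', msub'⟩, by omega⟩
    · exact ⟨by omega, fun _ => ⟨Set.inter_subset_right, Set.inter_subset_right⟩⟩
  · obtain rfl : r = 5 := by omega
    have e3 : (6 * q + 5 + 1) / 6 = q + 1 := by omega
    have e4 : (6 * q + 5 + 1) % 6 = 0 := by omega
    rw [e3, e4]
    exact ⟨fun _ => ⟨Set.inter_subset_left, Set.inter_subset_left⟩, by omega⟩

/-- The zigzag filtration
`(P₁, E₁) ⊇ ⋯ ⊇ (cl S₂, mo S₂) ⊆ ⋯ ⊆ (P₂, E₂) ⊇ ⋯ ⊇ (cl S₃, mo S₃) ⊆ ⋯ ⊆ (Pₙ, Eₙ)`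
of a sequence of connecting index pairs, where the dots are filled in by `linkPair`. -/
def contFiltration {F : Type*} [Field F] {n : ℕ} {𝒱 : ℕ → MultivectorField K}
    {S P E : ℕ → Set K.faces} (hn : 1 ≤ n) (h : IsConnectingSequence F n 𝒱 S P E) :
    ZigzagFiltration K (altOrientation (6 * (n - 1))) where
  pair j := contPair 𝒱 S P E j
  closed_fst j := (contPair_closed hn h (Nat.lt_succ_iff.1 j.2)).1
  closed_snd j := (contPair_closed hn h (Nat.lt_succ_iff.1 j.2)).2.1
  subset j := (contPair_closed hn h (Nat.lt_succ_iff.1 j.2)).2.2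
  step j := by
    by_cases hj : j.1 % 2 = 1
    · simpa [src, tgt, altOrientation, hj] using (contPair_step h j.2).1 hj
    · simpa [src, tgt, altOrientation, hj] using (contPair_step h j.2).2 hj

end Continuation

end CombDyn

open CombDyn

/-! Every inclusion in the filtration induces an isomorphism in homology. A zigzag module with
bijective maps has exactly one barcode (`ZigzagModule.isBarcode_iff_of_bijective`): its maps
identify all spaces with the first one, and in any interval decomposition each summand inherits
bijective maps, which excludes an interval with an end inside the zigzag.

An inclusion (A, B) ⊆ (A', B') factors through (A, A ∩ B') and (A ∪ B', B'). The middle step is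
excision, so it suffices that H(A ∩ B', B) and H(A', A ∪ B') vanish (`relHomologyMap_bijective`).

Vanishing comes from dynamics (`MultivectorField.isAcyclic_of_inv_eq_empty`). Let D \ C be a
nonempty union of multivectors with empty invariant part. None of them is critical, as a critical
one carries constant essential solutions. One of them is not entered through a face from another,
since otherwise following predecessors in a finite set yields a periodic essential solution.
Removing such a W leaves D closed and costs only H(cl W, mo W) = 0; induction finishes.

For an index pair (P, E) of S put A = pf(cl S, P) and B = pf(mo S, P). A path in P between points of
S stays in S, so B misses S and A = S ∪ B. Thus A \ B = S = cl S \ mo S, and (cl S, mo S) ⊆ (A, B)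
is an excision. The differences left by the other two inclusions, P \ (A ∪ E) and B \ E, are unions
of multivectors in P \ E that miss S = inv(P \ E), so their invariant parts are empty. -/

namespace CombDyn

/-! ### Classes in a subquotient -/

section Subquotient

variable {R M : Type*} [Ring R] [AddCommGroup M] [Module R M]

/-- The class in `Z / B` of an element of `Z`. -/
noncomputable def Subquotient.mk (Z B : Submodule R M) : Z →ₗ[R] Subquotient Z B :=
  Submodule.mkQ (B.submoduleOf Z)

theorem Subquotient.mk_surjective (Z B : Submodule R M) :
    Function.Surjective (Subquotient.mk Z B) :=
  Submodule.mkQ_surjective _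

theorem Subquotient.mk_eq_zero {Z B : Submodule R M} {z : Z} :
    Subquotient.mk Z B z = 0 ↔ (z : M) ∈ B :=
  Submodule.Quotient.mk_eq_zero (B.submoduleOf Z)

theorem Subquotient.map_mk {Z B Z' B' : Submodule R M} (hZ : Z ≤ Z') (hB : B ≤ B') (z : Z) :
    Subquotient.map hZ hB (Subquotient.mk Z B z) =
      Subquotient.mk Z' B' (Submodule.inclusion hZ z) :=
  rfl

end Subquotient

/-! ### Chains, acyclic pairs and excision -/

section Homology

variable {F : Type*} [Field F] {V : Type*} [LinearOrder V] {K : PreAbstractSimplicialComplex V}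

open Classical in
/-- The chain `1 • s` if the finite vertex set `s` is a simplex of `K`, and `0` otherwise. -/
noncomputable def simplexChain (F : Type*) [Field F] (K : PreAbstractSimplicialComplex V)
    (s : Finset V) : K.faces →₀ F :=
  if h : s ∈ K.faces then Finsupp.single ⟨s, h⟩ 1 else 0

/-- The empty set is admitted because deleting the only vertex of a simplex produces it; both sides
then vanish, and the formula can be iterated. -/
theorem boundary_simplexChain {s : Finset V} (hs : s ∈ K.faces ∨ s = ∅) :
    boundary F K (simplexChain F K s) =
      ∑ v ∈ s, (-1 : F) ^ (s.filter (· < v)).card • simplexChain F K (s.erase v) := by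
  classical
  by_cases h : s ∈ K.faces
  · rw [simplexChain, dif_pos h, boundary, Finsupp.linearCombination_single, one_smul]
    refine Finset.sum_congr rfl fun v _ => ?_
    by_cases hv : s.erase v ∈ K.faces <;> simp [simplexChain, hv]
  · obtain rfl := hs.resolve_left h
    simp [simplexChain, h]

theorem erase_mem_faces_or {s : Finset V} (hs : s ∈ K.faces) (v : V) :
    s.erase v ∈ K.faces ∨ s.erase v = ∅ := by
  rcases (s.erase v).eq_empty_or_nonempty with h | h
  · exact Or.inr h
  · exact Or.inl (K.isRelLowerSet_faces.mem_of_le hs (Finset.erase_subset v s) h)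

theorem boundary_single (σ : K.faces) :
    boundary F K (Finsupp.single σ 1) =
      ∑ v ∈ σ.1, (-1 : F) ^ (σ.1.filter (· < v)).card • simplexChain F K (σ.1.erase v) := by
  rw [← boundary_simplexChain (Or.inl σ.2), simplexChain, dif_pos σ.2]

/-- Deleting the smaller vertex `v` lowers the position of `w` by one, while deleting `w` does not
move `v`. -/
theorem neg_one_pow_erase_swap {s : Finset V} {v w : V} (hv : v ∈ s) (hvw : v < w) :
    (-1 : F) ^ (s.filter (· < v)).card * (-1) ^ ((s.erase v).filter (· < w)).card =
      -((-1) ^ (s.filter (· < w)).card * (-1) ^ ((s.erase w).filter (· < v)).card) := by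
  have h1 : (s.erase w).filter (· < v) = s.filter (· < v) := by
    ext x
    simp only [Finset.mem_filter, Finset.mem_erase]
    exact ⟨fun h => ⟨h.1.2, h.2⟩, fun h => ⟨⟨(h.2.trans hvw).ne, h.1⟩, h.2⟩⟩
  have h2 : (s.filter (· < w)).card = ((s.erase v).filter (· < w)).card + 1 := by
    rw [Finset.filter_erase, Finset.card_erase_add_one (Finset.mem_filter.2 ⟨hv, hvw⟩)]
  rw [h1, h2]
  ring

theorem boundary_boundary (c : K.faces →₀ F) : boundary F K (boundary F K c) = 0 := by
  suffices h : boundary F K ∘ₗ boundary F K = 0 from LinearMap.congr_fun h c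
  refine Finsupp.lhom_ext' fun σ => LinearMap.ext_ring ?_
  simp only [LinearMap.comp_apply, Finsupp.lsingle_apply, LinearMap.zero_apply, boundary_single,
    map_sum, map_smul]
  have h : ∀ v ∈ σ.1, (-1 : F) ^ (σ.1.filter (· < v)).card •
        boundary F K (simplexChain F K (σ.1.erase v)) =
      ∑ w ∈ σ.1.erase v, ((-1 : F) ^ (σ.1.filter (· < v)).card *
        (-1) ^ ((σ.1.erase v).filter (· < w)).card) •
          simplexChain F K ((σ.1.erase v).erase w) := fun v _ => by
    rw [boundary_simplexChain (erase_mem_faces_or σ.2 v), Finset.smul_sum]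
    exact Finset.sum_congr rfl fun w _ => smul_smul _ _ _
  rw [Finset.sum_congr rfl h, Finset.sum_sigma']
  -- The two orders of deleting `v` and `w` give the same set with opposite signs.
  refine Finset.sum_involution (fun x _ => ⟨x.2, x.1⟩) ?_ ?_ ?_ ?_
  · rintro ⟨v, w⟩ hx
    simp only [Finset.mem_sigma, Finset.mem_erase] at hx
    obtain ⟨hv, hwv, hw⟩ := hx
    dsimp only
    rw [Finset.erase_right_comm (a := w) (b := v), ← add_smul]
    rcases lt_or_gt_of_ne hwv with hlt | hlt
    · rw [neg_one_pow_erase_swap hw hlt, add_neg_cancel, zero_smul]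
    · rw [neg_one_pow_erase_swap hv hlt, neg_add_cancel, zero_smul]
  · rintro ⟨v, w⟩ hx _ h
    simp only [Finset.mem_sigma, Finset.mem_erase] at hx
    exact hx.2.1 (congrArg Sigma.fst h)
  · rintro ⟨v, w⟩ hx
    simp only [Finset.mem_sigma, Finset.mem_erase] at hx ⊢
    exact ⟨hx.2.2, hx.2.1.symm, hx.1⟩
  · exact fun _ _ => rfl

theorem mem_chains {k : ℕ} {A : Set K.faces} {c : K.faces →₀ F} :
    c ∈ chains F k A ↔ ∀ σ ∈ c.support, σ ∈ A ∧ σ.1.card = k + 1 :=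
  Finsupp.mem_supported F c

theorem chains_le_supported {k : ℕ} {A : Set K.faces} :
    chains F k A ≤ Finsupp.supported F F A :=
  Finsupp.supported_mono fun _ hσ => hσ.1

theorem mem_chains_of_mem_supported {k : ℕ} {A B : Set K.faces} {c : K.faces →₀ F}
    (hA : c ∈ chains F k A) (hB : c ∈ Finsupp.supported F F B) : c ∈ chains F k B :=
  mem_chains.2 fun σ hσ => ⟨(Finsupp.mem_supported F c).1 hB hσ, (mem_chains.1 hA σ hσ).2⟩

theorem exists_add_of_mem_chains {k : ℕ} {D A B : Set K.faces} (h : D ⊆ A ∪ B)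
    {c : K.faces →₀ F} (hc : c ∈ chains F k D) :
    ∃ a ∈ chains F k A, ∃ b ∈ chains F k B, a + b = c := by
  refine Submodule.mem_sup.1 ?_
  rw [chains, chains, ← Finsupp.supported_union]
  exact Finsupp.supported_mono (fun σ hσ => (h hσ.1).imp (⟨·, hσ.2⟩) (⟨·, hσ.2⟩)) hc

theorem simplexChain_mem_supported {s : Finset V} {A : Set K.faces}
    (h : ∀ hs : s ∈ K.faces, (⟨s, hs⟩ : K.faces) ∈ A) :
    simplexChain F K s ∈ Finsupp.supported F F A := by
  by_cases hs : s ∈ K.faces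
  · rw [simplexChain, dif_pos hs]
    exact Finsupp.single_mem_supported F 1 (h hs)
  · rw [simplexChain, dif_neg hs]
    exact zero_mem _

theorem boundary_mem_supported {A B : Set K.faces}
    (h : ∀ σ ∈ A, ∀ v ∈ σ.1, ∀ hs : σ.1.erase v ∈ K.faces, (⟨σ.1.erase v, hs⟩ : K.faces) ∈ B)
    {c : K.faces →₀ F} (hc : c ∈ Finsupp.supported F F A) :
    boundary F K c ∈ Finsupp.supported F F B := by
  suffices H : Finsupp.supported F F A ≤ (Finsupp.supported F F B).comap (boundary F K) from H hc
  rw [Finsupp.supported_eq_span_single, Submodule.span_le]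
  rintro _ ⟨σ, hσ, rfl⟩
  simp only [SetLike.mem_coe, Submodule.mem_comap, boundary_single]
  exact Submodule.sum_mem _ fun v hv =>
    Submodule.smul_mem _ _ (simplexChain_mem_supported (h σ hσ v hv))

theorem boundary_mem_supported_of_isLowerSet {A : Set K.faces} (hA : IsLowerSet A)
    {c : K.faces →₀ F} (hc : c ∈ Finsupp.supported F F A) :
    boundary F K c ∈ Finsupp.supported F F A :=
  boundary_mem_supported (fun σ hσ v _ _ => hA (Finset.erase_subset v σ.1) hσ) hc

theorem boundary_mem_chains {k : ℕ} {A : Set K.faces} (hA : IsLowerSet A)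
    {c : K.faces →₀ F} (hc : c ∈ chains F (k + 1) A) : boundary F K c ∈ chains F k A := by
  have h : ∀ σ ∈ {σ : K.faces | σ ∈ A ∧ σ.1.card = k + 1 + 1}, ∀ v ∈ σ.1,
      ∀ hs : σ.1.erase v ∈ K.faces,
        (⟨σ.1.erase v, hs⟩ : K.faces) ∈ {σ : K.faces | σ ∈ A ∧ σ.1.card = k + 1} :=
    fun σ hσ v hv hs => ⟨hA (Finset.erase_subset v σ.1) hσ.1, by
      rw [Finset.card_erase_of_mem hv, hσ.2, Nat.add_sub_cancel]⟩
  exact boundary_mem_supported h hc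

theorem boundary_eq_zero_of_mem_chains_zero {A : Set K.faces} {c : K.faces →₀ F}
    (hc : c ∈ chains F 0 A) : boundary F K c = 0 := by
  have h : boundary F K c ∈ Finsupp.supported F F (∅ : Set K.faces) := by
    refine boundary_mem_supported (fun σ hσ v hv hs => ?_) hc
    have hne : (σ.1.erase v).Nonempty := K.isRelLowerSet_faces.prop_of_mem hs
    have := hσ.2
    rw [← Finset.card_pos, Finset.card_erase_of_mem hv] at hne
    omega
  rwa [Finsupp.supported_empty, Submodule.mem_bot] at h

theorem mem_relCycles {k : ℕ} {P E : Set K.faces} {c : K.faces →₀ F} :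
    c ∈ relCycles F k P E ↔ c ∈ chains F k P ∧ boundary F K c ∈ Finsupp.supported F F E :=
  Iff.rfl

theorem mem_relBoundaries {k : ℕ} {P E : Set K.faces} {c : K.faces →₀ F} :
    c ∈ relBoundaries F k P E ↔
      ∃ w ∈ chains F (k + 1) P, ∃ e ∈ chains F k E, boundary F K w + e = c := by
  simp [relBoundaries, Submodule.mem_sup]

/-- A pair of sets of simplices all of whose relative homology groups vanish. -/
def IsAcyclic (F : Type*) [Field F] (D C : Set K.faces) : Prop :=
  ∀ k, relCycles F k D C ≤ relBoundaries F k D C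

theorem IsAcyclic.exists {D C : Set K.faces} (h : IsAcyclic F D C) {k : ℕ} {z : K.faces →₀ F}
    (hz : z ∈ chains F k D) (hb : boundary F K z ∈ Finsupp.supported F F C) :
    ∃ w ∈ chains F (k + 1) D, ∃ e ∈ chains F k C, z = boundary F K w + e := by
  obtain ⟨w, hw, e, he, rfl⟩ := mem_relBoundaries.1 (h k ⟨hz, hb⟩)
  exact ⟨w, hw, e, he, rfl⟩

/-- In a pair `(D, C)` with vanishing homology, a boundary in `D` is homologous in `D` to a
chain of `C`. -/
theorem IsAcyclic.exists_boundary_sub_mem {D C A : Set K.faces} (h : IsAcyclic F D C) {k : ℕ}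
    {z : K.faces →₀ F} (hA : IsLowerSet A) (hz : z ∈ chains F k A)
    (hb : boundary F K z ∈ Finsupp.supported F F D) :
    ∃ v ∈ chains F k D, boundary F K (z - v) ∈ Finsupp.supported F F C := by
  -- In degree 0 there is no boundary to correct, so `v = 0` works.
  rcases k with _ | k
  · exact ⟨0, zero_mem _, by simp [boundary_eq_zero_of_mem_chains_zero hz]⟩
  · obtain ⟨v, hv, e, he, h⟩ := h.exists
      (mem_chains_of_mem_supported (boundary_mem_chains hA hz) hb)
      (by rw [boundary_boundary]; exact zero_mem _)
    exact ⟨v, hv, by rw [map_sub, h, add_sub_cancel_left]; exact chains_le_supported he⟩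

theorem isAcyclic_of_subset {D C : Set K.faces} (h : D ⊆ C) : IsAcyclic F D C := fun k _ hz =>
  mem_relBoundaries.2 ⟨0, zero_mem _, _, chains_mono F k h hz.1, by simp⟩

/-- Exactness for the triple C ⊆ D' ⊆ D: a relative cycle is first pushed into D', and what remains
is a cycle of (D', C). -/
theorem IsAcyclic.trans {D D' C : Set K.faces} (h : IsAcyclic F D D') (h' : IsAcyclic F D' C)
    (hD : D' ⊆ D) (hC : C ⊆ D') : IsAcyclic F D C := by
  intro k z hz
  obtain ⟨w, hw, d, hd, rfl⟩ := h.exists hz.1 (Finsupp.supported_mono hC hz.2)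
  have hb := (mem_relCycles.1 hz).2
  rw [map_add, boundary_boundary, zero_add] at hb
  obtain ⟨w', hw', e, he, rfl⟩ := h'.exists hd hb
  exact mem_relBoundaries.2
    ⟨w + w', add_mem hw (chains_mono F _ hD hw'), e, he, by rw [map_add, add_assoc]⟩

theorem isAcyclic_cl_mo {W : Set K.faces} (h : ¬ IsCritical F W) : IsAcyclic F (cl W) (mo W) := by
  intro k z hz
  have hs : Subsingleton (RelHomology F k (cl W) (mo W)) :=
    not_nontrivial_iff_subsingleton.1 fun hk => h ⟨k, hk⟩
  exact (Subquotient.mk_eq_zero (z := ⟨z, hz⟩)).1 (Subsingleton.elim _ _)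

/-- The homology of `(D, D \ W)` vanishes if `W` is noncritical. -/
theorem isAcyclic_diff {D W : Set K.faces} (hW : ¬ IsCritical F W) (hD : IsLowerSet D)
    (hDW : IsLowerSet (D \ W)) (hWD : W ⊆ D) : IsAcyclic F D (D \ W) := by
  intro k z hz
  have hcl : cl W ⊆ D := fun τ ⟨σ, hσ, h⟩ => hD h (hWD hσ)
  -- Excision: the boundary of the part in cl W lies both in cl W and in D \ W, hence in mo W.
  obtain ⟨a, ha, b, hb, rfl⟩ := exists_add_of_mem_chains (A := cl W) (B := D \ W)
    (fun σ hσ => or_iff_not_imp_left.2 fun h => ⟨hσ, fun hσW => h ⟨σ, hσW, le_rfl⟩⟩) hz.1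
  have hba : boundary F K a ∈ Finsupp.supported F F (mo W) := by
    have h1 : boundary F K a ∈ Finsupp.supported F F (D \ W) := by
      have h2 := sub_mem (mem_relCycles.1 hz).2 (boundary_mem_supported_of_isLowerSet hDW (chains_le_supported hb))
      rwa [map_add, add_sub_cancel_right] at h2
    have h3 := boundary_mem_supported_of_isLowerSet (isLowerSet_cl W) (chains_le_supported ha)
    have h4 : boundary F K a ∈ Finsupp.supported F F (cl W ∩ (D \ W)) := by
      rw [Finsupp.supported_inter]
      exact ⟨h3, h1⟩
    exact Finsupp.supported_mono (fun σ hσ => (⟨hσ.1, hσ.2.2⟩ : σ ∈ mo W)) h4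
  obtain ⟨w, hw, e, he, rfl⟩ := (isAcyclic_cl_mo hW).exists ha hba
  exact mem_relBoundaries.2 ⟨w, chains_mono F _ hcl hw, e + b,
    add_mem (chains_mono F _ (Set.sdiff_subset_sdiff_left hcl) he) hb, by rw [add_assoc]⟩

/-- An inclusion of closed pairs `(A, B) ⊆ (A', B')` induces isomorphisms in homology if the
homology of `(A', A ∪ B')` and of `(A ∩ B', B)` vanishes. -/
theorem relHomologyMap_bijective {p q : Set K.faces × Set K.faces} (h : p ≤ q)
    (hp₁ : IsLowerSet p.1) (hq₂ : IsLowerSet q.2)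
    (h₁ : IsAcyclic F q.1 (p.1 ∪ q.2)) (h₂ : IsAcyclic F (p.1 ∩ q.2) p.2) (k : ℕ) :
    Function.Bijective (relHomologyMap F k h) := by
  have hB : ∀ {c : K.faces →₀ F}, c ∈ Finsupp.supported F F p.1 → c ∈ Finsupp.supported F F q.2 →
      c ∈ Finsupp.supported F F (p.1 ∩ q.2) := fun h h' => by
    rw [Finsupp.supported_inter]
    exact ⟨h, h'⟩
  constructor
  · rw [injective_iff_map_eq_zero]
    intro x hx
    obtain ⟨⟨z, hz⟩, rfl⟩ := Subquotient.mk_surjective _ _ x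
    rw [relHomologyMap, Subquotient.map_mk, Subquotient.mk_eq_zero] at hx
    rw [Subquotient.mk_eq_zero]
    change z ∈ _ at hx
    change z ∈ _
    obtain ⟨c, hc, e, he, rfl⟩ := mem_relBoundaries.1 hx
    -- Since `∂c = z - e` is supported on `p.1 ∪ q.2`, up to a boundary `c` is `a + b` with `a` in
    -- `p.1` and `b` in `q.2`. Then `z = ∂a + (∂b + e)`, and the bracket lies in `p.1 ∩ q.2`, where
    -- `h₂` applies.
    obtain ⟨w, -, d, hd, rfl⟩ := h₁.exists hc (by
      have h3 := sub_mem
        (Finsupp.supported_mono Set.subset_union_left (chains_le_supported hz.1) :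
          _ ∈ Finsupp.supported F F (p.1 ∪ q.2))
        (Finsupp.supported_mono Set.subset_union_right (chains_le_supported he))
      rwa [add_sub_cancel_right] at h3)
    obtain ⟨a, ha, b, hb, rfl⟩ := exists_add_of_mem_chains subset_rfl hd
    rw [map_add, boundary_boundary, zero_add, map_add, add_assoc] at hz ⊢
    have ha' := boundary_mem_chains hp₁ ha
    have hy : boundary F K b + e ∈ chains F k q.2 := add_mem (boundary_mem_chains hq₂ hb) he
    have hy' : boundary F K b + e ∈ chains F k (p.1 ∩ q.2) := by
      refine mem_chains_of_mem_supported hy (hB ?_ (chains_le_supported hy))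
      have h3 := chains_le_supported (sub_mem hz.1 ha')
      rwa [add_sub_cancel_left] at h3
    have hy'' := (mem_relCycles.1 hz).2
    rw [map_add, boundary_boundary, zero_add] at hy''
    obtain ⟨v, hv, b', hb', h3⟩ := h₂.exists hy' hy''
    rw [h3]
    exact mem_relBoundaries.2 ⟨a + v, add_mem ha (chains_mono F _ Set.inter_subset_left hv), b', hb',
      by rw [map_add, add_assoc]⟩
  · intro y
    obtain ⟨⟨z, hz⟩, rfl⟩ := Subquotient.mk_surjective _ _ y
    -- Up to a boundary and a chain of `q.2`, `z` is a chain `a` of `p.1` with boundary in `p.1 ∩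
    -- q.2`; `h₂` corrects it to a relative cycle of `p`.
    obtain ⟨w, hw, d, hd, h3⟩ :=
      h₁.exists hz.1 (Finsupp.supported_mono Set.subset_union_right hz.2)
    obtain ⟨a, ha, b, hb, rfl⟩ := exists_add_of_mem_chains subset_rfl hd
    have ha' : boundary F K a ∈ Finsupp.supported F F q.2 := by
      have h4 := sub_mem (mem_relCycles.1 hz).2 (boundary_mem_supported_of_isLowerSet hq₂ (chains_le_supported hb))
      rwa [h3, map_add, boundary_boundary, zero_add, map_add, add_sub_cancel_right] at h4
    obtain ⟨v, hv, hav⟩ := h₂.exists_boundary_sub_mem hp₁ ha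
      (hB (boundary_mem_supported_of_isLowerSet hp₁ (chains_le_supported ha)) ha')
    have hz' : a - v ∈ relCycles F k p.1 p.2 :=
      ⟨sub_mem ha (chains_mono F _ Set.inter_subset_left hv), hav⟩
    refine ⟨Subquotient.mk _ _ ⟨a - v, hz'⟩, ?_⟩
    rw [relHomologyMap, Subquotient.map_mk, ← sub_eq_zero, ← map_sub, Subquotient.mk_eq_zero]
    change (a - v) - z ∈ _
    refine mem_relBoundaries.2 ⟨-w, neg_mem hw, -(b + v),
      neg_mem (add_mem hb (chains_mono F _ Set.inter_subset_right hv)), ?_⟩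
    rw [h3, map_neg]
    abel

end Homology

/-! ### Essential solutions and vanishing homology -/

section Dynamics

variable {F : Type*} [Field F] {V : Type*} [LinearOrder V] {K : PreAbstractSimplicialComplex V}

theorem isLowerSet_diff_of_subset {D W : Set K.faces} (hD : IsLowerSet D)
    (h : ∀ σ ∈ W, ∀ τ ∈ D, σ ≤ τ → τ ∈ W) : IsLowerSet (D \ W) :=
  fun a b hba ha => ⟨hD hba ha.1, fun hb => ha.2 (h b hb a ha.1 hba)⟩

namespace MultivectorField

variable (𝒱 : MultivectorField K)

/-- A set of simplices that is a union of multivectors. -/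
def IsCompatible (X : Set K.faces) : Prop := ∀ σ ∈ X, 𝒱.mv σ ⊆ X

variable {𝒱}

theorem mem_mv_self (σ : K.faces) : σ ∈ 𝒱.mv σ := 𝒱.toSetoid.refl σ

theorem mv_eq_of_mem {σ τ : K.faces} (h : τ ∈ 𝒱.mv σ) : 𝒱.mv τ = 𝒱.mv σ :=
  Set.ext fun _ => ⟨fun hx => 𝒱.toSetoid.trans hx h,
    fun hx => 𝒱.toSetoid.trans hx (𝒱.toSetoid.symm h)⟩

theorem mem_mv_comm {σ τ : K.faces} : τ ∈ 𝒱.mv σ ↔ σ ∈ 𝒱.mv τ :=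
  ⟨𝒱.toSetoid.symm, 𝒱.toSetoid.symm⟩

theorem mem_map_of_le {σ τ : K.faces} (h : τ ≤ σ) : τ ∈ 𝒱.map σ := Or.inl ⟨σ, rfl, h⟩

theorem mem_map_of_mem_mv {σ τ : K.faces} (h : τ ∈ 𝒱.mv σ) : τ ∈ 𝒱.map σ := Or.inr h

theorem mem_map_iff {σ τ : K.faces} : τ ∈ 𝒱.map σ ↔ τ ≤ σ ∨ τ ∈ 𝒱.mv σ := by
  simp [map, cl]

theorem mem_mapSet {A : Set K.faces} {σ τ : K.faces} (hσ : σ ∈ A) (h : τ ∈ 𝒱.map σ) :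
    τ ∈ 𝒱.mapSet A :=
  Set.mem_biUnion hσ h

theorem IsCompatible.diff {X Y : Set K.faces} (hX : 𝒱.IsCompatible X) (hY : 𝒱.IsCompatible Y) :
    𝒱.IsCompatible (X \ Y) :=
  fun _ hσ _ hτ => ⟨hX _ hσ.1 hτ, fun h => hσ.2 (hY _ h (mem_mv_comm.1 hτ))⟩

theorem isCompatible_mv (σ : K.faces) : 𝒱.IsCompatible (𝒱.mv σ) :=
  fun _ hτ => (mv_eq_of_mem hτ).subset

theorem inv_mono {A B : Set K.faces} (h : A ⊆ B) : 𝒱.inv F A ⊆ 𝒱.inv F B :=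
  fun _ ⟨ρ, hρ, hA, hi⟩ => ⟨ρ, hρ, fun i => h (hA i), hi⟩

theorem inv_subset (A : Set K.faces) : 𝒱.inv F A ⊆ A := by
  rintro _ ⟨ρ, _, hA, i, rfl⟩
  exact hA i

theorem mem_inv_of_isCritical {σ : K.faces} {A : Set K.faces} (hσ : σ ∈ A)
    (h : IsCritical F (𝒱.mv σ)) : σ ∈ 𝒱.inv F A :=
  ⟨fun _ => σ, ⟨fun _ => mem_map_of_le le_rfl, fun _ hi => absurd h hi⟩, fun _ => hσ, 0, rfl⟩

/-- If every multivector in a finite nonempty set `X` can be entered from a different multivector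
in `X`, then `X` contains a periodic essential solution. -/
theorem inv_nonempty_of_forall_exists [Finite K.faces] {X : Set K.faces} (hX : X.Nonempty)
    (h : ∀ σ ∈ X, ∃ τ ∈ X, ∃ τ' ∈ X, τ' ∈ 𝒱.mv σ ∧ τ' ≤ τ ∧ 𝒱.mv τ ≠ 𝒱.mv σ) :
    (𝒱.inv F X).Nonempty := by
  choose g hg y hy hyσ hyg hgσ using h
  -- `G` chooses a predecessor, so its iterates run backwards in time; finiteness gives a periodic
  -- point.
  let G : X → X := fun σ => ⟨g σ σ.2, hg σ σ.2⟩
  obtain ⟨x₀, hx₀⟩ := hX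
  obtain ⟨x, hx⟩ : (Function.periodicPts G).Nonempty := by
    obtain ⟨m, n, hne, hmn⟩ :=
      Finite.exists_ne_map_eq_of_infinite fun n : ℕ => G^[n] ⟨x₀, hx₀⟩
    wlog hlt : m < n generalizing m n
    · exact this n m hne.symm hmn.symm (by omega)
    refine ⟨G^[m] ⟨x₀, hx₀⟩, Function.mk_mem_periodicPts (Nat.sub_pos_of_lt hlt) ?_⟩
    rw [Function.IsPeriodicPt, Function.IsFixedPt, ← Function.iterate_add_apply,
      Nat.sub_add_cancel hlt.le]
    exact hmn.symm
  let e : Equiv.Perm (Function.periodicPts G) := (Function.bijOn_periodicPts G).equiv G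
  have he : ∀ z, ((e z : X) : K.faces) = g z.1 z.1.2 := fun _ => rfl
  -- The exponent `-i` restores forward time: `u i = G (u (i + 1))`.
  let u : ℤ → X := fun i => ((e ^ (-i)) ⟨x, hx⟩ : Function.periodicPts G)
  have hu : ∀ i, (u i : K.faces) = g (u (i + 1)) (u (i + 1)).2 := fun i => by
    have : (e ^ (-i)) ⟨x, hx⟩ = e ((e ^ (-(i + 1))) ⟨x, hx⟩) := by
      rw [← Equiv.Perm.mul_apply, ← zpow_one_add]
      congr 2
      ring
    change (((e ^ (-i)) ⟨x, hx⟩ : Function.periodicPts G) : K.faces) = _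
    rw [this, he]
  -- From `u j` the solution descends to a face in the multivector of `u (j + 1)`, then moves inside
  -- that multivector to `u (j + 1)`.
  let ρ : ℤ → K.faces := fun i => if i % 2 = 0 then u (i / 2) else y (u (i / 2 + 1)) (u _).2
  have h0 : ∀ j, ρ (2 * j) = u j := fun j => by
    have h1 : 2 * j % 2 = 0 := by omega
    have h2 : 2 * j / 2 = j := by omega
    simp only [ρ, h1, h2, if_true]
  have h1 : ∀ j, ρ (2 * j + 1) = y (u (j + 1)) (u (j + 1)).2 := fun j => by
    have h1 : ¬ (2 * j + 1) % 2 = 0 := by omega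
    have h2 : (2 * j + 1) / 2 = j := by omega
    simp only [ρ, h1, h2, if_false]
  have hmv : ∀ j, 𝒱.mv (ρ (2 * j)) ≠ 𝒱.mv (ρ (2 * (j + 1))) := fun j => by
    rw [h0, h0, hu]
    exact hgσ _ _
  -- Consecutive even positions lie in different multivectors, so one of them avoids that of `ρ i`.
  -- The offsets `i / 2 - 2` and `i / 2 + 1` below place both before, respectively after, `i`.
  have hleave : ∀ i j, 𝒱.mv (ρ (2 * j)) ≠ 𝒱.mv (ρ i) ∨ 𝒱.mv (ρ (2 * (j + 1))) ≠ 𝒱.mv (ρ i) :=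
    fun i j => by
      by_contra! hc
      exact hmv j (hc.1.trans hc.2.symm)
  refine ⟨ρ 0, ρ, ⟨fun i => ?_, fun i _ => ?_⟩, fun i => ?_, 0, rfl⟩
  · obtain ⟨j, rfl | rfl⟩ := Int.even_or_odd' i
    · rw [h1, h0]
      refine mem_map_of_le ?_
      have := hyg (u (j + 1)) (u (j + 1)).2
      rwa [← hu] at this
    · rw [h1, add_assoc, show (2 * j + (1 + 1) : ℤ) = 2 * (j + 1) by ring, h0]
      exact mem_map_of_mem_mv (mem_mv_comm.1 (hyσ _ _))
  · obtain ⟨i₁, hi₁, hne₁⟩ : ∃ i₁ < i, 𝒱.mv (ρ i₁) ≠ 𝒱.mv (ρ i) := by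
      rcases hleave i (i / 2 - 2) with h | h
      · exact ⟨_, by omega, h⟩
      · exact ⟨_, by omega, h⟩
    obtain ⟨i₂, hi₂, hne₂⟩ : ∃ i₂ > i, 𝒱.mv (ρ i₂) ≠ 𝒱.mv (ρ i) := by
      rcases hleave i (i / 2 + 1) with h | h
      · exact ⟨_, by omega, h⟩
      · exact ⟨_, by omega, h⟩
    exact ⟨i₁, i₂, hi₁, hi₂, hne₁, hne₂.symm⟩
  · obtain ⟨j, rfl | rfl⟩ := Int.even_or_odd' i
    · rw [h0]
      exact (u j).2
    · rw [h1]
      exact hy _ _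

/-- The homology of a closed pair `(D, C)` vanishes if `D \ C` is a union of multivectors with
empty invariant part. -/
theorem isAcyclic_of_inv_eq_empty [Finite K.faces] {D C : Set K.faces} (hD : IsLowerSet D)
    (hC : IsLowerSet C) (hCD : C ⊆ D) (hX : 𝒱.IsCompatible (D \ C)) (hinv : 𝒱.inv F (D \ C) = ∅) :
    IsAcyclic F D C := by
  induction hn : (D \ C).ncard using Nat.strong_induction_on generalizing D with
  | _ n ih =>
  rcases (D \ C).eq_empty_or_nonempty with h0 | h0
  · exact isAcyclic_of_subset (Set.sdiff_eq_empty.1 h0)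
  -- A topmost multivector: removing it from `D` leaves a closed set.
  obtain ⟨σ, hσ, hmax⟩ : ∃ σ ∈ D \ C, ∀ τ ∈ D \ C, ∀ τ' ∈ D \ C, τ' ∈ 𝒱.mv σ → τ' ≤ τ →
      𝒱.mv τ = 𝒱.mv σ := by
    by_contra! hc
    exact (inv_nonempty_of_forall_exists (F := F) h0 hc).ne_empty hinv
  have hsub : 𝒱.mv σ ⊆ D \ C := hX σ hσ
  have hdiff : (D \ 𝒱.mv σ) \ C = (D \ C) \ 𝒱.mv σ := Set.sdiff_sdiff_comm
  have hD' : IsLowerSet (D \ 𝒱.mv σ) := isLowerSet_diff_of_subset hD fun τ' hτ' τ hτ hle =>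
    (hmax τ ⟨hτ, fun h => (hsub hτ').2 (hC hle h)⟩ τ' (hsub hτ') hτ' hle).subset (mem_mv_self τ)
  have hcrit : ¬ IsCritical F (𝒱.mv σ) := fun h =>
    (Set.eq_empty_iff_forall_notMem.1 hinv) σ (mem_inv_of_isCritical hσ h)
  have hCD' : C ⊆ D \ 𝒱.mv σ := fun x hx => ⟨hCD hx, fun h => (hsub h).2 hx⟩
  refine (isAcyclic_diff hcrit hD hD' (hsub.trans Set.sdiff_subset)).trans
    (ih ((D \ 𝒱.mv σ) \ C).ncard ?_ hD' ?_ ?_ ?_ rfl) Set.sdiff_subset hCD'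
  · rw [hdiff, ← hn]
    exact Set.ncard_lt_ncard ⟨Set.sdiff_subset, fun h => (h hσ).2 (mem_mv_self σ)⟩
  · exact hCD'
  · rw [hdiff]
    exact hX.diff (isCompatible_mv σ)
  · rw [hdiff]
    exact Set.subset_empty_iff.1 (hinv ▸ inv_mono Set.sdiff_subset)

end MultivectorField

end Dynamics

/-! ### Index pairs and push forwards -/

section IndexPairs

variable {F : Type*} [Field F] {V : Type*} [LinearOrder V] {K : PreAbstractSimplicialComplex V}

namespace MultivectorField

variable {𝒱 : MultivectorField K}

theorem IsEssential.exists_gt {ρ : ℤ → K.faces} (h : 𝒱.IsEssential F ρ) {i : ℤ}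
    (hi : ¬ IsCritical F (𝒱.mv (ρ i))) : ∃ j > i, 𝒱.mv (ρ j) ≠ 𝒱.mv (ρ i) := by
  obtain ⟨_, j, _, hj, _, hne⟩ := h.2 i hi
  exact ⟨j, hj, hne.symm⟩

theorem IsEssential.exists_lt {ρ : ℤ → K.faces} (h : 𝒱.IsEssential F ρ) {i : ℤ}
    (hi : ¬ IsCritical F (𝒱.mv (ρ i))) : ∃ j < i, 𝒱.mv (ρ j) ≠ 𝒱.mv (ρ i) := by
  obtain ⟨j, _, hj, _, hne, _⟩ := h.2 i hi
  exact ⟨j, hj, hne⟩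

/-- A path in `X` that starts and ends in the invariant part of `X` stays in it. -/
theorem IsPath.mem_inv {X : Set K.faces} {n : ℕ} {γ : ℕ → K.faces} (hγ : 𝒱.IsPath X n γ)
    (h0 : γ 0 ∈ 𝒱.inv F X) (hn : γ n ∈ 𝒱.inv F X) {i : ℕ} (hi : i ≤ n) : γ i ∈ 𝒱.inv F X := by
  obtain ⟨ρ₁, h₁, hX₁, a, ha⟩ := h0
  obtain ⟨ρ₂, h₂, hX₂, b, hb⟩ := hn
  -- Arrive along `ρ₁`, follow `γ` during `0, …, n`, depart along `ρ₂`; the descriptions agree at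
  -- the two junctions.
  let ρ : ℤ → K.faces := fun i =>
    if i < 0 then ρ₁ (i + a) else if i ≤ n then γ i.toNat else ρ₂ (i - n + b)
  have hmid : ∀ j : ℕ, j ≤ n → ρ j = γ j := fun j hj => by
    have h1 : ¬ (j : ℤ) < 0 := by omega
    have h2 : (j : ℤ) ≤ n := by omega
    simp only [ρ, h1, h2, if_false, if_true, Int.toNat_natCast]
  have hneg : ∀ j ≤ 0, ρ j = ρ₁ (j + a) := fun j hj => by
    rcases hj.lt_or_eq with h | rfl
    · simp only [ρ, h, if_true]
    · rw [zero_add, ha]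
      exact hmid 0 (Nat.zero_le n)
  have hpos : ∀ j ≥ (n : ℤ), ρ j = ρ₂ (j - n + b) := fun j hj => by
    rcases hj.lt_or_eq with h | rfl
    · have h1 : ¬ j < 0 := by omega
      have h2 : ¬ j ≤ n := by omega
      simp only [ρ, h1, h2, if_false]
    · rw [sub_self, zero_add, hb]
      exact hmid n le_rfl
  refine ⟨ρ, ⟨fun j => ?_, fun j hj => ?_⟩, fun j => ?_, i, hmid i hi⟩
  · rcases lt_or_ge j 0 with hj | hj
    · rw [hneg j hj.le, hneg (j + 1) (by omega), add_right_comm]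
      exact h₁.1 _
    · rcases lt_or_ge j n with hjn | hjn
      · lift j to ℕ using hj
        rw [hmid j (by omega), ← Nat.cast_succ, hmid (j + 1) (by omega)]
        exact hγ.2 j (by omega)
      · rw [hpos j hjn, hpos (j + 1) (by omega),
          show j + 1 - n + b = j - n + b + 1 by ring]
        exact h₂.1 _
  · have hback : ∃ j₁ < j, 𝒱.mv (ρ j₁) ≠ 𝒱.mv (ρ j) := by
      by_cases hm : 𝒱.mv (ρ (min j 0)) = 𝒱.mv (ρ j)
      · have hm' := hneg (min j 0) (min_le_right _ _)
        obtain ⟨l, hl, hne⟩ := h₁.exists_lt (i := min j 0 + a) (by rwa [← hm', hm])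
        refine ⟨l - a, by omega, ?_⟩
        rwa [hneg (l - a) (by omega), sub_add_cancel, ← hm, hm']
      · exact ⟨_, lt_of_le_of_ne (min_le_left _ _) fun h => hm (by rw [h]), hm⟩
    have hforth : ∃ j₂ > j, 𝒱.mv (ρ j₂) ≠ 𝒱.mv (ρ j) := by
      by_cases hm : 𝒱.mv (ρ (max j n)) = 𝒱.mv (ρ j)
      · have hm' := hpos (max j n) (le_max_right _ _)
        obtain ⟨l, hl, hne⟩ := h₂.exists_gt (i := max j n - n + b) (by rwa [← hm', hm])
        refine ⟨l - b + n, by omega, ?_⟩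
        rwa [hpos (l - b + n) (by omega), add_sub_cancel_right, sub_add_cancel, ← hm, hm']
      · exact ⟨_, lt_of_le_of_ne (le_max_left _ _) fun h => hm (by rw [← h]), hm⟩
    obtain ⟨j₁, hj₁, hne₁⟩ := hback
    obtain ⟨j₂, hj₂, hne₂⟩ := hforth
    exact ⟨j₁, j₂, hj₁, hj₂, hne₁, hne₂.symm⟩
  · rcases lt_or_ge j 0 with hj | hj
    · rw [hneg j hj.le]
      exact hX₁ _
    · rcases lt_or_ge j n with hjn | hjn
      · lift j to ℕ using hj
        rw [hmid j (by omega)]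
        exact hγ.1 j (by omega)
      · rw [hpos j hjn]
        exact hX₂ _

theorem pf_subset (A N : Set K.faces) : 𝒱.pf A N ⊆ N := by
  rintro _ ⟨n, ρ, hρ, _, rfl⟩
  exact hρ.1 n le_rfl

theorem mem_pf_of_mem_map {A N : Set K.faces} {σ τ : K.faces} (hσ : σ ∈ 𝒱.pf A N) (hτN : τ ∈ N)
    (hτ : τ ∈ 𝒱.map σ) : τ ∈ 𝒱.pf A N := by
  obtain ⟨n, ρ, ⟨hρ, hs⟩, h0, rfl⟩ := hσ
  refine ⟨n + 1, fun i => if i ≤ n then ρ i else τ, ⟨fun i _ => ?_, fun i hi => ?_⟩, ?_, ?_⟩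
  · by_cases h : i ≤ n
    · simpa [h] using hρ i h
    · simpa [h] using hτN
  · rcases Nat.lt_succ_iff_lt_or_eq.1 hi with h | rfl
    · simpa [h.le, Nat.succ_le_of_lt h] using hs i h
    · simpa using hτ
  · simpa using h0
  · simp

theorem pf_subset_of_forall {A N T : Set K.faces} (hA : A ⊆ T)
    (hT : ∀ σ ∈ T, ∀ τ ∈ N, τ ∈ 𝒱.map σ → τ ∈ T) : 𝒱.pf A N ⊆ T := by
  rintro _ ⟨n, ρ, ⟨hρ, hs⟩, h0, rfl⟩
  suffices h : ∀ i ≤ n, ρ i ∈ T from h n le_rfl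
  intro i
  induction i with
  | zero => exact fun _ => hA h0
  | succ i ih => exact fun hi => hT _ (ih (by omega)) _ (hρ _ hi) (hs i hi)

/-- For τ in [σ] the path σ, τ, σ lies in the isolating set and has its endpoints in S. -/
theorem IsIsolatedInvariant.isCompatible {S : Set K.faces} (h : 𝒱.IsIsolatedInvariant F S) :
    𝒱.IsCompatible S := by
  obtain ⟨N, hN⟩ := h
  intro σ hσ τ hτ
  refine hN.path_mem 2 (fun i => if i = 1 then τ else σ) ⟨fun i _ => ?_, fun i hi => ?_⟩
    (by simpa using hσ) (by simpa using hσ) 1 (by norm_num)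
  · dsimp only
    split_ifs
    · exact hN.map_subset (mem_mapSet hσ (mem_map_of_mem_mv hτ))
    · exact hN.map_subset (mem_mapSet hσ (mem_map_of_le le_rfl))
  · interval_cases i
    · exact mem_map_of_mem_mv hτ
    · exact mem_map_of_mem_mv (mem_mv_comm.1 hτ)

namespace IsIndexPair

variable {S P E : Set K.faces}

theorem subset_diff (h : 𝒱.IsIndexPair F S P E) : S ⊆ P \ E :=
  h.inv_eq.subset.trans (inv_subset _)

theorem mem_snd_of_mem_map (h : 𝒱.IsIndexPair F S P E) {σ τ : K.faces} (hσ : σ ∈ E)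
    (hτ : τ ∈ 𝒱.map σ) (hτP : τ ∈ P) : τ ∈ E :=
  h.map_exit ⟨mem_mapSet hσ hτ, hτP⟩

/-- A point of [σ] stays in P; if it were in E, a step back to σ would put σ in E. -/
theorem isCompatible_diff (h : 𝒱.IsIndexPair F S P E) : 𝒱.IsCompatible (P \ E) :=
  fun _ hσ _ hτ => ⟨h.map_diff (mem_mapSet hσ (mem_map_of_mem_mv hτ)), fun hE =>
    hσ.2 (h.mem_snd_of_mem_map hE (mem_map_of_mem_mv (mem_mv_comm.1 hτ)) hσ.1)⟩

/-- A path in `P` with both endpoints in `S` lies in `S`. -/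
theorem path_mem (h : 𝒱.IsIndexPair F S P E) {n : ℕ} {γ : ℕ → K.faces} (hγ : 𝒱.IsPath P n γ)
    (h0 : γ 0 ∈ S) (hn : γ n ∈ S) {i : ℕ} (hi : i ≤ n) : γ i ∈ S := by
  -- A path in `P` that enters `E` never leaves it, but `γ n` is outside `E`.
  have hE : ∀ i ≤ n, γ i ∉ E := fun i hi hiE => by
    have : ∀ j, i ≤ j → j ≤ n → γ j ∈ E := fun j hij => by
      induction j, hij using Nat.le_induction with
      | base => exact fun _ => hiE
      | succ j _ ih => exact fun hj =>
          h.mem_snd_of_mem_map (ih (by omega)) (hγ.2 j hj) (hγ.1 _ hj)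
    exact (h.subset_diff hn).2 (this n hi le_rfl)
  have hγ' : 𝒱.IsPath (P \ E) n γ := ⟨fun i hi => ⟨hγ.1 i hi, hE i hi⟩, hγ.2⟩
  rw [h.inv_eq] at h0 hn ⊢
  exact hγ'.mem_inv h0 hn hi

/-- The push forward of the mouth of `S` in `P` is disjoint from `S`. -/
theorem disjoint_pf_mo (h : 𝒱.IsIndexPair F S P E) : Disjoint S (𝒱.pf (mo S) P) := by
  rw [Set.disjoint_left]
  rintro _ hS ⟨n, ρ, ⟨hρ, hs⟩, ⟨⟨s, hs', hle⟩, h0⟩, rfl⟩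
  -- Prepending `s` gives a path from `S` to `S` through `ρ 0`, which is not in `S`.
  have hpath : 𝒱.IsPath P (n + 1) fun i => Nat.casesOn i s ρ := by
    refine ⟨fun i hi => ?_, fun i hi => ?_⟩
    · rcases i with _ | i
      · exact (h.subset_diff hs').1
      · exact hρ i (by omega)
    · rcases i with _ | i
      · exact mem_map_of_le hle
      · exact hs i (by omega)
  exact h0 (h.path_mem hpath hs' hS (i := 1) (by omega))

theorem mo_subset_pf (h : 𝒱.IsIndexPair F S P E) : mo S ⊆ 𝒱.pf (mo S) P :=
  𝒱.subset_pf ((mo_subset_cl S).trans h.cl_subset)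

theorem subset_pf_cl (h : 𝒱.IsIndexPair F S P E) : S ⊆ 𝒱.pf (cl S) P :=
  fun σ hσ => 𝒱.subset_pf h.cl_subset ⟨σ, hσ, le_rfl⟩

/-- The right side contains cl S and is closed under steps in P: from S a step goes to a face or
stays in a multivector inside S. -/
theorem pf_cl_subset (h : 𝒱.IsIndexPair F S P E) : 𝒱.pf (cl S) P ⊆ S ∪ 𝒱.pf (mo S) P := by
  have hcl : cl S ⊆ S ∪ 𝒱.pf (mo S) P := fun σ hσ =>
    or_iff_not_imp_left.2 fun hS => h.mo_subset_pf ⟨hσ, hS⟩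
  refine pf_subset_of_forall hcl fun σ hσ τ hτP hτ => ?_
  rcases hσ with hσ | hσ
  · rcases mem_map_iff.1 hτ with hle | hmv
    · exact hcl ⟨σ, hσ, hle⟩
    · exact Or.inl (h.isolated.isCompatible σ hσ hmv)
  · exact Or.inr (mem_pf_of_mem_map hσ hτP hτ)

theorem isCompatible_inter_pf (h : 𝒱.IsIndexPair F S P E) (A : Set K.faces) :
    𝒱.IsCompatible ((P \ E) ∩ 𝒱.pf A P) := fun σ hσ _ hτ =>
  have hτ' := h.isCompatible_diff σ hσ.1 hτ
  ⟨hτ', mem_pf_of_mem_map hσ.2 hτ'.1 (mem_map_of_mem_mv hτ)⟩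

theorem inv_eq_empty_of_disjoint (h : 𝒱.IsIndexPair F S P E) {X : Set K.faces} (hX : X ⊆ P \ E)
    (hXS : Disjoint S X) : 𝒱.inv F X = ∅ := by
  refine Set.eq_empty_iff_forall_notMem.2 fun σ hσ => ?_
  exact Set.disjoint_left.1 hXS (h.inv_eq.superset (inv_mono hX hσ)) (inv_subset X hσ)

/-- With A and B the two push forwards, A ∩ E ⊆ B because S misses E, and P \ (A ∪ E) misses S. -/
theorem bijective_inter_pf_of_indexPair [Finite K.faces] (h : 𝒱.IsIndexPair F S P E) (k : ℕ)
    (hle : (P ∩ 𝒱.pf (cl S) P, E ∩ 𝒱.pf (mo S) P) ≤ (P, E)) :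
    Function.Bijective (relHomologyMap F k hle) := by
  have hA := 𝒱.isLowerSet_pf (cl S) h.closed_fst
  refine relHomologyMap_bijective hle (h.closed_fst.inter hA) h.closed_snd ?_
    (isAcyclic_of_subset ?_) k
  · have heq : P \ (P ∩ 𝒱.pf (cl S) P ∪ E) = (P \ E) \ ((P \ E) ∩ 𝒱.pf (cl S) P) := by
      ext σ
      simp only [Set.mem_sdiff, Set.mem_union, Set.mem_inter_iff]
      tauto
    refine isAcyclic_of_inv_eq_empty (𝒱 := 𝒱) h.closed_fst
      ((h.closed_fst.inter hA).union h.closed_snd)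
      (Set.union_subset Set.inter_subset_left h.subset) ?_ ?_
    · rw [heq]
      exact h.isCompatible_diff.diff (h.isCompatible_inter_pf _)
    · rw [heq]
      refine h.inv_eq_empty_of_disjoint Set.sdiff_subset (Set.disjoint_left.2 fun σ hσ hX => ?_)
      exact hX.2 ⟨h.subset_diff hσ, h.subset_pf_cl hσ⟩
  · rintro σ ⟨⟨-, hσ⟩, hσE⟩
    exact ⟨hσE, (h.pf_cl_subset hσ).resolve_left fun hS => (h.subset_diff hS).2 hσE⟩

/-- Push forwards lie in P, so the first components agree; the second ones differ by (P \ E) ∩ pf(mo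
S, P), which misses S. -/
theorem bijective_inter_pf_of_pf [Finite K.faces] (h : 𝒱.IsIndexPair F S P E) (k : ℕ)
    (hle : (P ∩ 𝒱.pf (cl S) P, E ∩ 𝒱.pf (mo S) P) ≤ (𝒱.pf (cl S) P, 𝒱.pf (mo S) P)) :
    Function.Bijective (relHomologyMap F k hle) := by
  have hA := 𝒱.isLowerSet_pf (cl S) h.closed_fst
  have hB := 𝒱.isLowerSet_pf (mo S) h.closed_fst
  have hBA := 𝒱.pf_mono (mo_subset_cl S) P
  refine relHomologyMap_bijective hle (h.closed_fst.inter hA) hB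
    (isAcyclic_of_subset fun σ hσ => Or.inl ⟨pf_subset _ _ hσ, hσ⟩) ?_ k
  have heq : (P ∩ 𝒱.pf (cl S) P ∩ 𝒱.pf (mo S) P) \ (E ∩ 𝒱.pf (mo S) P) =
      (P \ E) ∩ 𝒱.pf (mo S) P := by
    ext σ
    have := @hBA σ
    simp only [Set.mem_sdiff, Set.mem_inter_iff]
    tauto
  refine isAcyclic_of_inv_eq_empty (𝒱 := 𝒱) ((h.closed_fst.inter hA).inter hB)
    (h.closed_snd.inter hB) (fun σ hσ => ⟨⟨h.subset hσ.1, hBA hσ.2⟩, hσ.2⟩) ?_ ?_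
  · rw [heq]
    exact h.isCompatible_inter_pf _
  · rw [heq]
    exact h.inv_eq_empty_of_disjoint Set.inter_subset_left
      (h.disjoint_pf_mo.mono_right Set.inter_subset_right)

/-- Pure excision: both differences equal S. -/
theorem bijective_cl_mo_of_pf (h : 𝒱.IsIndexPair F S P E) (k : ℕ)
   (hle : (cl S, mo S) ≤ (𝒱.pf (cl S) P, 𝒱.pf (mo S) P)) :
    Function.Bijective (relHomologyMap F k hle) := by
  refine relHomologyMap_bijective hle (isLowerSet_cl S) (𝒱.isLowerSet_pf (mo S) h.closed_fst)
    (isAcyclic_of_subset fun σ hσ => ?_)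
    (isAcyclic_of_subset fun σ hσ => ⟨hσ.1, fun hS => ?_⟩) k
  · exact (h.pf_cl_subset hσ).imp (fun hS => ⟨σ, hS, le_rfl⟩) id
  · exact Set.disjoint_left.1 h.disjoint_pf_mo hS hσ.2

end IsIndexPair

end MultivectorField

end IndexPairs

/-! ### Zigzag modules with bijective maps -/

section Zigzag

variable {F : Type*} [Field F] {L : ℕ} {o : Fin L → Bool}

theorem mem_fullBar (i : Fin (L + 1)) : i ∈ fullBar L :=
  ⟨Fin.zero_le i, Fin.le_last i⟩

theorem eq_fullBar_of_forall_mem {J : NonemptyInterval (Fin (L + 1))} (h : ∀ i, i ∈ J) :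
    J = fullBar L :=
  NonemptyInterval.ext (Prod.ext (le_antisymm (h 0).1 (Fin.zero_le _))
    (le_antisymm (Fin.le_last _) (h (Fin.last L)).2))

theorem src_tgt_cases (o : Fin L → Bool) (i : Fin L) :
    (src o i = i.castSucc ∧ tgt o i = i.succ) ∨ (src o i = i.succ ∧ tgt o i = i.castSucc) := by
  by_cases h : o i <;> simp [src, tgt, h]

/-- A map between F and 0 is never bijective. -/
theorem src_mem_iff_tgt_mem {J : NonemptyInterval (Fin (L + 1))} {i : Fin L}
    (h : Function.Bijective ((intervalModule F o J).map i)) : src o i ∈ J ↔ tgt o i ∈ J := by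
  constructor
  · intro hs
    by_contra ht
    have h0 : (fun _ => 1 : PLift (src o i ∈ J) → F) = fun _ => 0 :=
      h.1 (funext fun x => absurd x.down ht)
    exact one_ne_zero (congrFun h0 ⟨hs⟩)
  · intro ht
    classical
    by_contra hs
    obtain ⟨x, hx⟩ := h.2 (fun _ => 1 : PLift (tgt o i ∈ J) → F)
    have h1 : dite (src o i ∈ J) (fun h => x ⟨h⟩) (fun _ => 0) = 1 := congrFun hx ⟨ht⟩
    rw [dif_neg hs] at h1
    exact zero_ne_one h1

theorem eq_fullBar_of_bijective {J : NonemptyInterval (Fin (L + 1))}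
    (h : ∀ i, Function.Bijective ((intervalModule F o J).map i)) : J = fullBar L := by
  have hstep : ∀ i : Fin L, i.castSucc ∈ J ↔ i.succ ∈ J := fun i => by
    have := src_mem_iff_tgt_mem (h i)
    rcases src_tgt_cases o i with ⟨h1, h2⟩ | ⟨h1, h2⟩
    · rwa [h1, h2] at this
    · rw [h1, h2] at this
      exact this.symm
  have hall : ∀ i, i ∈ J ↔ 0 ∈ J := fun i => by
    induction i using Fin.induction with
    | zero => rfl
    | succ i ih => rw [← hstep, ih]
  have h0 : 0 ∈ J := (hall J.fst).1 ⟨le_rfl, J.fst_le_snd⟩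
  exact eq_fullBar_of_forall_mem fun i => (hall i).2 h0

theorem ZigzagModule.bijective_of_directSum {ι : Type} [Fintype ι] {M : ι → ZigzagModule F o}
    {i : Fin L} (h : Function.Bijective ((ZigzagModule.directSum M).map i)) (j : ι) :
    Function.Bijective ((M j).map i) := by
  classical
  have hinj := h.1
  have hsurj := h.2
  constructor
  · rw [injective_iff_map_eq_zero]
    intro x hx
    have h0 : (Pi.single j x : ∀ j, (M j).obj (src o i)) = 0 := by
      refine (injective_iff_map_eq_zero ((ZigzagModule.directSum M).map i)).1 hinj _
        (funext fun j' => ?_)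
      change (M j').map i (Pi.single (M := fun j => (M j).obj (src o i)) j x j') = 0
      by_cases hj : j' = j
      · subst hj
        rwa [Pi.single_eq_same]
      · rw [Pi.single_eq_of_ne hj, map_zero]
    simpa using congrFun h0 j
  · intro y
    obtain ⟨x, hx⟩ := hsurj (Pi.single j y : ∀ j, (M j).obj (tgt o i))
    refine ⟨(x : ∀ j, (M j).obj (src o i)) j, ?_⟩
    have := congrFun (f := (ZigzagModule.directSum M).map i x) hx j
    rwa [Pi.single_eq_same] at this

theorem ZigzagModule.Iso.bijective {M N : ZigzagModule F o} (e : M.Iso N) {i : Fin L}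
    (h : Function.Bijective (M.map i)) : Function.Bijective (N.map i) := by
  have : (N.map i : N.obj (src o i) → N.obj (tgt o i)) =
      e.equiv (tgt o i) ∘ M.map i ∘ (e.equiv (src o i)).symm := funext fun x => by
    simp [e.comm]
  rw [this]
  exact (e.equiv _).bijective.comp (h.comp (e.equiv _).symm.bijective)

/-- The vector spaces of a zigzag module whose maps are bijective can be identified with a single
vector space in such a way that all the maps become identities. -/
theorem ZigzagModule.exists_equiv_const {M : ZigzagModule F o}
    (h : ∀ i, Function.Bijective (M.map i)) {W : Type*} [AddCommGroup W] [Module F W]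
    (e₀ : M.obj 0 ≃ₗ[F] W) :
    ∃ e : ∀ i, M.obj i ≃ₗ[F] W, ∀ i x, e (tgt o i) (M.map i x) = e (src o i) x := by
  -- The positions are kept as free variables so that the equations for source and target can be
  -- substituted away despite the dependent types.
  have aux : ∀ (c d s t : Fin (L + 1)) (_ : (s = c ∧ t = d) ∨ (s = d ∧ t = c))
      (f : M.obj s →ₗ[F] M.obj t) (_ : Function.Bijective f) (a : M.obj c ≃ₗ[F] W),
      ∃ b : M.obj d ≃ₗ[F] W, ∀ e : ∀ i, M.obj i ≃ₗ[F] W, e c = a → e d = b →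
        ∀ x, e t (f x) = e s x := by
    rintro c d s t (⟨rfl, rfl⟩ | ⟨rfl, rfl⟩) f hf a
    · refine ⟨(LinearEquiv.ofBijective f hf).symm.trans a, fun e h1 h2 x => ?_⟩
      rw [h1, h2, LinearEquiv.trans_apply]
      exact congrArg a ((LinearEquiv.ofBijective f hf).symm_apply_apply x)
    · exact ⟨(LinearEquiv.ofBijective f hf).trans a, fun e h1 h2 x => by rw [h1, h2]; rfl⟩
  choose b hb using fun i : Fin L => aux _ _ _ _ (src_tgt_cases o i) (M.map i) (h i)
  refine ⟨Fin.induction (motive := fun i => M.obj i ≃ₗ[F] W) e₀ b, fun i => ?_⟩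
  exact hb i _ _ rfl (Fin.induction_succ _ _ _)

/-- A zigzag module whose maps are bijective has exactly one barcode. It consists of full bars, as
many as the dimension of the vector spaces. -/
theorem ZigzagModule.isBarcode_iff_of_bijective {M : ZigzagModule F o}
    [Module.Finite F (M.obj 0)] (h : ∀ i, Function.Bijective (M.map i))
    (B : Multiset (NonemptyInterval (Fin (L + 1)))) :
    M.IsBarcode B ↔ B = Multiset.replicate (Module.finrank F (M.obj 0)) (fullBar L) := by
  constructor
  · rintro ⟨ι, _, J, rfl, ⟨e⟩⟩
    have hJ : ∀ j, J j = fullBar L := fun j =>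
      eq_fullBar_of_bijective fun i => ZigzagModule.bijective_of_directSum (e.bijective (h i)) j
    obtain rfl : J = fun _ => fullBar L := funext hJ
    have hd : Module.finrank F (M.obj 0) = Fintype.card ι := by
      have : Unique (PLift ((0 : Fin (L + 1)) ∈ fullBar L)) :=
        ⟨⟨⟨mem_fullBar 0⟩⟩, fun _ => rfl⟩
      rw [(e.equiv 0).finrank_eq]
      change Module.finrank F (ι → PLift ((0 : Fin (L + 1)) ∈ fullBar L) → F) = _
      rw [Module.finrank_pi_fintype]
      simp
    rw [Multiset.map_const', hd]
    rfl
  · rintro rfl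
    refine ⟨Fin (Module.finrank F (M.obj 0)), inferInstance, fun _ => fullBar L, ?_, ?_⟩
    · rw [Multiset.map_const']
      simp
    · obtain ⟨e, he⟩ := ZigzagModule.exists_equiv_const h
        (Module.finBasis F (M.obj 0)).equivFun
      let u : ∀ i : Fin (L + 1), F ≃ₗ[F] (PLift (i ∈ fullBar L) → F) := fun i =>
        haveI : Unique (PLift (i ∈ fullBar L)) := ⟨⟨⟨mem_fullBar i⟩⟩, fun _ => rfl⟩
        (LinearEquiv.funUnique _ F F).symm
      refine ⟨⟨fun i => (e i).trans (LinearEquiv.piCongrRight fun _ => u i), fun i x => ?_⟩⟩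
      classical
      funext j y
      change e (tgt o i) (M.map i x) j =
        dite (src o i ∈ fullBar L) (fun h => u (src o i) (e (src o i) x j) ⟨h⟩) (fun _ => 0)
      rw [dif_pos (mem_fullBar _), he]
      rfl

end Zigzag

/-! ### The maps of the continuation filtration -/

section Continuation

variable {F : Type*} [Field F] {V : Type*} [LinearOrder V] {K : PreAbstractSimplicialComplex V}

/-- An inclusion of pairs `p ⊆ q`, if it holds, induces an isomorphism in `H_k`. -/
def InducesHomologyIso (F : Type*) [Field F] (k : ℕ) (p q : Set K.faces × Set K.faces) : Prop :=
  ∀ h : p ≤ q, Function.Bijective (relHomologyMap F k h)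

/-- Both ends of a link are index pairs for the same set under the same field `𝒱 (q + 2)`, so the
three isomorphisms for one index pair serve on the way in and, reversed, on the way out. -/
theorem inducesHomologyIso_contPair [Finite K.faces] {n : ℕ} {𝒱 : ℕ → MultivectorField K}
    {S P E : ℕ → Set K.faces} (h : IsConnectingSequence F n 𝒱 S P E) (k : ℕ) {j : ℕ}
    (hj : j < 6 * (n - 1)) :
    (j % 2 = 1 → InducesHomologyIso F k (contPair 𝒱 S P E j) (contPair 𝒱 S P E (j + 1))) ∧
      (¬ j % 2 = 1 →
        InducesHomologyIso F k (contPair 𝒱 S P E (j + 1)) (contPair 𝒱 S P E j)) := by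
  obtain ⟨q, r, hr, rfl⟩ : ∃ q r, r < 6 ∧ j = 6 * q + r :=
    ⟨j / 6, j % 6, Nat.mod_lt _ (by norm_num), (Nat.div_add_mod j 6).symm⟩
  have e1 : (6 * q + r) / 6 = q := by omega
  have e2 : (6 * q + r) % 6 = r := by omega
  obtain ⟨-, h2⟩ := h (q + 1) (by omega) (by omega)
  obtain ⟨h3, -⟩ := h (q + 1 + 1) (by omega) (by omega)
  simp only [contPair, e1, e2]
  rcases Nat.lt_or_ge r 5 with hr5 | hr5
  · have e3 : (6 * q + r + 1) / 6 = q := by omega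
    have e4 : (6 * q + r + 1) % 6 = r + 1 := by omega
    rw [e3, e4]
    interval_cases r
    · exact ⟨by omega, fun _ hle => h2.bijective_inter_pf_of_indexPair k hle⟩
    · exact ⟨fun _ hle => h2.bijective_inter_pf_of_pf k hle, by omega⟩
    · exact ⟨by omega, fun _ hle => h2.bijective_cl_mo_of_pf k hle⟩
    · exact ⟨fun _ hle => h3.bijective_cl_mo_of_pf k hle, by omega⟩
    · exact ⟨by omega, fun _ hle => h3.bijective_inter_pf_of_pf k hle⟩
  · obtain rfl : r = 5 := by omega
    have e3 : (6 * q + 5 + 1) / 6 = q + 1 := by omega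
    have e4 : (6 * q + 5 + 1) % 6 = 0 := by omega
    rw [e3, e4]
    exact ⟨fun _ hle => h3.bijective_inter_pf_of_indexPair k hle, by omega⟩

/-- All the maps in the zigzag module of a sequence of connecting index pairs are bijective. -/
theorem contFiltration_homology_bijective [Finite K.faces] {n : ℕ} {𝒱 : ℕ → MultivectorField K}
    {S P E : ℕ → Set K.faces} (hn : 1 ≤ n) (h : IsConnectingSequence F n 𝒱 S P E) (k : ℕ)
    (i : Fin (6 * (n - 1))) :
    Function.Bijective (((contFiltration hn h).homology F k).map i) := by
  -- Quantifying over the proof of inclusion allows source and target to be rewritten.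
  suffices hi : InducesHomologyIso F k ((contFiltration hn h).pair (src (altOrientation _) i))
      ((contFiltration hn h).pair (tgt (altOrientation _) i)) from hi ((contFiltration _ _).step i)
  have hpair : ∀ j, (contFiltration hn h).pair j = contPair 𝒱 S P E j := fun _ => rfl
  by_cases hi : i.1 % 2 = 1
  · simpa [hpair, src, tgt, altOrientation, hi] using (inducesHomologyIso_contPair h k i.2).1 hi
  · simpa [hpair, src, tgt, altOrientation, hi] using (inducesHomologyIso_contPair h k i.2).2 hi

theorem finite_relHomology [Finite K.faces] (k : ℕ) (P E : Set K.faces) :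
    Module.Finite F (RelHomology F k P E) :=
  Module.Finite.of_surjective (Subquotient.mk _ _) (Subquotient.mk_surjective _ _)

end Continuation

end CombDyn

theorem mainTheorem1 {F : Type*} [Field F] {V : Type*} [LinearOrder V]
    (K : PreAbstractSimplicialComplex V) (hK : K.faces.Finite)
    (n : ℕ) (hn : 1 ≤ n) (𝒱 : ℕ → MultivectorField K) (S P E : ℕ → Set K.faces)
    (h : IsConnectingSequence F n 𝒱 S P E) (k : ℕ)
    (B : Multiset (NonemptyInterval (Fin (6 * (n - 1) + 1)))) :
    ((contFiltration hn h).homology F k).IsBarcode B ↔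
      B = Multiset.replicate (Module.finrank F (RelHomology F k (P 1) (E 1)))
        (fullBar (6 * (n - 1))) := by
  have : Finite K.faces := hK
  have : Module.Finite F (((contFiltration hn h).homology F k).obj 0) :=
    finite_relHomology k ((contFiltration hn h).pair 0).1 ((contFiltration hn h).pair 0).2
  have hpair : (contFiltration hn h).pair 0 = (P 1, E 1) := by
    change contPair 𝒱 S P E ((0 : Fin (6 * (n - 1) + 1)) : ℕ) = _
    rw [Fin.val_zero]
    rfl
  have hrank : Module.finrank F (RelHomology F k (P 1) (E 1)) =
      Module.finrank F (((contFiltration hn h).homology F k).obj 0) := by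
    change _ = Module.finrank F
      (RelHomology F k ((contFiltration hn h).pair 0).1 ((contFiltration hn h).pair 0).2)
    rw [hpair]
  rw [hrank]
  exact ZigzagModule.isBarcode_iff_of_bijective (contFiltration_homology_bijective hn h k) B
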